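/- All $C^*$-algebras are separable and unital, representations are unital, and Hilbert spaces are complex. An odd spectral triple $(\mathcal A,\mathsf H,D)$ on $A$ consists of a representation $\pi:A\to B(\mathsf H)$, a dense unital $*$-subalgebra $\mathcal A\subset A$ and a densely defined self-adjoint operator $D$ on $\mathsf H$ with $(1+D^2)^{-1/2}$ compact (equivalently, $\mathsf H$ has an orthonormal basis of eigenvectors of $D$ such that, for every $R>0$, only finitely many of them have eigenvalue in $[-R,R]$), such that for all $a\in\mathcal A$ the operator $\pi(a)$ preserves the domain of $D$ and $[D,\pi(a)]$ extends to a bounded operator; put $L_D(a)=\|[D,\pi(a)]\|$. The triple is even if moreover $\mathsf H=\mathsf H_0\oplus\mathsf H_1$ with respect to which $\pi=\pi_0\oplus\pi_1$ and $D=\begin{bmatrix}0&D_0\\D_0^*&0\end{bmatrix}$. The triple satisfies the Lipschitz condition (induces a Lip-metric, making $(A,L_D)$ a compact quantum metric space) if $$d(\omega_1,\omega_2)=\sup\{|\omega_1(a)-\omega_2(a)|:a\in\mathcal A,\ L_D(a)\le 1\}$$ is a (finite) metric on the state space of $A$ whose topology is the weak-$*$ topology. In that case an action $\alpha:\mathbb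 Z\to\mathrm{Aut}(A)$ is metrically equicontinuous if $\alpha_n(\mathcal A)\subset\mathcal A$ for all $n\in\mathbb Z$ and $\sup_{n\in\mathbb Z}L_D(\alpha_n(a))<\infty$ for all $a\in\mathcal A$. **Theorem.** Let $(\mathcal A,\mathsf H_A,D_A)$ be an odd spectral triple, with faithful representation $\pi$, on a unital $C^*$-algebra $A$. Assume that it satisfies the Lipschitz condition, and let $\alpha:\mathbb Z\to\mathrm{Aut}(A)$ be a metrically equicontinuous action. Let $\mathsf H=\mathsf H_A\otimes\ell^2(\mathbb Z)$ and realise $A\rtimes_\alpha\mathbb Z$ as the $C^*$-algebra of operators on $\mathsf H$ generated by the operators $$\tilde\pi(a)(\xi\otimes\delta_n)=\pi(\alpha_{-n}(a))\xi\otimes\delta_n,\qquad \lambda_m(\xi\otimes\delta_n)=\xi\otimes\delta_{m+n}\qquad(a\in A,\ m\in\mathbb Z).$$ Let $C_c(\mathbb Z,\mathcal A)$ be the set of finite sums $\sum_n\tilde\pi(x_n)\lambda_n$ with $x_n\in\mathcal A$, let $M_\iota$ be the self-adjoint operator of multiplication by the identity function $\iota(n)=n$ on $\ell^2(\mathbb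 Z)$, and put $$D=\begin{bmatrix}0&D_A\otimes1-i\otimes M_\iota\\D_A\otimes1+i\otimes M_\iota&0\end{bmatrix}$$ on $\mathsf H\oplus\mathsf H$, where $D_A\otimes 1$ and $1\otimes M_\iota$ denote the self-adjoint operators on $\mathsf H$ and their combinations are defined on the intersection of the two domains. Then $(C_c(\mathbb Z,\mathcal A),\mathsf H\oplus\mathsf H,D)$, with the representation $x\mapsto x\oplus x$, is an even spectral triple on $A\rtimes_\alpha\mathbb Z$, and it induces a Lip-metric on the state space of $A\rtimes_\alpha\mathbb Z$. -/

import Mathlib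

open scoped lp

namespace QuantumMetric

noncomputable section

/-! ### States, Lipschitz seminorms and the induced metric -/

open scoped ComplexOrder in
/-- The state space of a unital C⋆-algebra: positive linear functionals `φ` with `φ 1 = 1`.
As a subset of the weak dual it carries the weak-⋆ topology. -/
def stateSpace (A : Type*) [CStarAlgebra A] : Set (WeakDual ℂ A) :=
  {φ | φ 1 = 1 ∧ ∀ a : A, 0 ≤ φ (star a * a)}

/-- The pseudometric `d(φ, ψ) = sup {|φ a - ψ a| : a ∈ 𝒜, L a ≤ 1}` (with values in `[0, ∞]`)
induced on the state space by a seminorm `L` on a subalgebra `𝒜`. -/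
def stateDist {A : Type*} [CStarAlgebra A] (𝒜 : StarSubalgebra ℂ A) (L : 𝒜 → ℝ)
    (φ ψ : stateSpace A) : ENNReal :=
  ⨆ (a : 𝒜) (_ : L a ≤ 1), edist (φ.1 (a : A)) (ψ.1 (a : A))

/-- `L` induces a Lip-metric: `stateDist 𝒜 L` is a genuine (finite, point-separating) metric on
the state space, and the topology of this metric is the weak-⋆ topology. -/
def InducesLipMetric {A : Type*} [CStarAlgebra A] (𝒜 : StarSubalgebra ℂ A) (L : 𝒜 → ℝ) : Prop :=
  ∃ m : MetricSpace (stateSpace A),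
    (∀ φ ψ : stateSpace A, m.edist φ ψ = stateDist 𝒜 L φ ψ) ∧
    m.toPseudoMetricSpace.toUniformSpace.toTopologicalSpace =
      (instTopologicalSpaceSubtype : TopologicalSpace (stateSpace A))

/-! ### Spectral triples -/

/-- `D` has compact resolvent, i.e. it is diagonalisable with finite-dimensional eigenspaces and
the absolute values of its eigenvalues tend to infinity: there is an orthonormal basis of
eigenvectors with real eigenvalues `μ i`, only finitely many of which (with multiplicity) lie in
any bounded set. -/
def HasCompactResolvent {H : Type*} [NormedAddCommGroup H] [InnerProductSpace ℂ H]
    (D : H →ₗ.[ℂ] H) : Prop :=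
  ∃ (w : Set H) (b : HilbertBasis w ℂ H) (μ : w → ℝ),
    (∀ i, ∃ h : b i ∈ D.domain, D ⟨b i, h⟩ = (μ i : ℂ) • b i) ∧
    Filter.Tendsto (fun i => |μ i|) Filter.cofinite Filter.atTop

/-- `T` maps the domain of `D` into itself and the bounded operator `S` extends the commutator
`[D, T] = D T - T D`. -/
def ExtendsCommutator {H : Type*} [NormedAddCommGroup H] [InnerProductSpace ℂ H]
    (D : H →ₗ.[ℂ] H) (T S : H →L[ℂ] H) : Prop :=
  ∀ x : D.domain, ∃ h : T x ∈ D.domain, D ⟨T x, h⟩ - T (D x) = S x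

/-- An odd spectral triple on a separable unital C⋆-algebra `A`, acting on the Hilbert
space `H`. -/
structure OddSpectralTriple (A H : Type*) [CStarAlgebra A] [NormedAddCommGroup H]
    [InnerProductSpace ℂ H] [CompleteSpace H] where
  separable_algebra : TopologicalSpace.SeparableSpace A
  /-- The dense unital ⋆-subalgebra. -/
  alg : StarSubalgebra ℂ A
  dense_alg : Dense (alg : Set A)
  /-- The (unital) representation of `A` on `H`. -/
  rep : A →⋆ₐ[ℂ] (H →L[ℂ] H)
  /-- The Dirac operator. -/
  D : H →ₗ.[ℂ] H
  dense_domain : Dense (D.domain : Set H)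
  selfAdjoint : IsSelfAdjoint D
  compactResolvent : HasCompactResolvent D
  bounded_commutator : ∀ a ∈ alg, ∃ S : H →L[ℂ] H, ExtendsCommutator D (rep a) S

namespace OddSpectralTriple

variable {A H : Type*} [CStarAlgebra A] [NormedAddCommGroup H] [InnerProductSpace ℂ H]
  [CompleteSpace H]

/-- The bounded operator `[D, π(a)]`, for `a` in the dense subalgebra (it is unique, since `D` is
densely defined). -/
def commutator (T : OddSpectralTriple A H) (a : T.alg) : H →L[ℂ] H :=
  Classical.choose (T.bounded_commutator a a.2)

/-- The seminorm `L_D(a) = ‖[D, π(a)]‖`. -/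
def lipSeminorm (T : OddSpectralTriple A H) (a : T.alg) : ℝ := ‖T.commutator a‖

/-- The Lipschitz condition: the triple induces a Lip-metric on the state space. -/
def LipschitzCondition (T : OddSpectralTriple A H) : Prop :=
  InducesLipMetric T.alg T.lipSeminorm

/-- An action `α` of `ℤ` on `A` is metrically equicontinuous for `L_D`: it is smooth (each `α_n`
leaves the dense subalgebra invariant) and `sup_n L_D(α_n(a)) < ∞` for all `a` in that
subalgebra. -/
def MetricallyEquicontinuous (T : OddSpectralTriple A H)
    (α : Multiplicative ℤ →* (A ≃⋆ₐ[ℂ] A)) : Prop :=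
  ∃ smooth : ∀ (g : Multiplicative ℤ), ∀ a ∈ T.alg, α g a ∈ T.alg,
    ∀ a : T.alg, BddAbove (Set.range fun g => T.lipSeminorm ⟨α g a, smooth g a a.2⟩)

end OddSpectralTriple

/-- The operator matrix `[[0, S], [T, 0]]` on `H₀ ⊕ H₁`, with domain `dom T ⊕ dom S`. -/
def offDiagonal {H₀ H₁ : Type*} [NormedAddCommGroup H₀] [InnerProductSpace ℂ H₀]
    [NormedAddCommGroup H₁] [InnerProductSpace ℂ H₁]
    (S : H₁ →ₗ.[ℂ] H₀) (T : H₀ →ₗ.[ℂ] H₁) :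
    WithLp 2 (H₀ × H₁) →ₗ.[ℂ] WithLp 2 (H₀ × H₁) where
  domain :=
    { carrier := {x | x.fst ∈ T.domain ∧ x.snd ∈ S.domain}
      add_mem' := fun hx hy => ⟨T.domain.add_mem hx.1 hy.1, S.domain.add_mem hx.2 hy.2⟩
      zero_mem' := ⟨T.domain.zero_mem, S.domain.zero_mem⟩
      smul_mem' := fun c _ hx => ⟨T.domain.smul_mem c hx.1, S.domain.smul_mem c hx.2⟩ }
  toFun :=
    { toFun := fun x => WithLp.toLp 2 (S ⟨x.1.snd, x.2.2⟩, T ⟨x.1.fst, x.2.1⟩)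
      map_add' := fun x y => by
        rw [← WithLp.toLp_add, Prod.mk_add_mk, ← S.map_add, ← T.map_add]
        rfl
      map_smul' := fun c x => by
        rw [RingHom.id_apply, ← WithLp.toLp_smul, Prod.smul_mk, ← S.map_smul, ← T.map_smul]
        rfl }

/-- An even spectral triple on `A`: a triple on `H₀ ⊕ H₁` with respect to which
`π = π₀ ⊕ π₁` and `D = [[0, D₀], [D₀⋆, 0]]`. -/
structure EvenSpectralTriple (A H₀ H₁ : Type*) [CStarAlgebra A]
    [NormedAddCommGroup H₀] [InnerProductSpace ℂ H₀] [CompleteSpace H₀]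
    [NormedAddCommGroup H₁] [InnerProductSpace ℂ H₁] [CompleteSpace H₁]
    extends OddSpectralTriple A (WithLp 2 (H₀ × H₁)) where
  rep₀ : A →⋆ₐ[ℂ] (H₀ →L[ℂ] H₀)
  rep₁ : A →⋆ₐ[ℂ] (H₁ →L[ℂ] H₁)
  rep_eq : ∀ (a : A) (x : WithLp 2 (H₀ × H₁)),
    rep a x = WithLp.toLp 2 (rep₀ a x.fst, rep₁ a x.snd)
  D₀ : H₁ →ₗ.[ℂ] H₀
  dense_domain₀ : Dense (D₀.domain : Set H₁)
  D_eq : D = offDiagonal D₀ D₀.adjoint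

/-! ### The crossed product by `ℤ`

The Hilbert space `H ⊗ ℓ²(ℤ)` is realised as `ℓ²(ℤ, H)`; the vector `ξ ⊗ δ_n` is
`lp.single 2 n ξ`. -/

section Operators

variable {H : Type*} [NormedAddCommGroup H] [InnerProductSpace ℂ H]

/-- A bounded family `(S_n)` of operators acts diagonally on `ℓ²(ℤ, H)`. -/
def diagonalOp (S : ℤ → H →L[ℂ] H) (C : ℝ) (hS : ∀ n, ‖S n‖ ≤ C) : ℓ²(ℤ, H) →L[ℂ] ℓ²(ℤ, H) :=
  have key : ∀ (x : ℓ²(ℤ, H)) (n : ℤ), ‖S n (x n)‖ ≤ ‖(C • x : ℓ²(ℤ, H)) n‖ := fun x n => by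
    rw [lp.coeFn_smul, Pi.smul_apply, norm_smul]
    exact (S n).le_of_opNorm_le ((hS n).trans (le_abs_self C)) _
  LinearMap.mkContinuous
    { toFun := fun x => ⟨fun n => S n (x n), (lp.memℓp (C • x)).mono' (key x)⟩
      map_add' := fun x y => by
        ext n
        exact (S n).map_add (x n) (y n)
      map_smul' := fun c x => by ext n; simp } C (fun x => by
        have hC : 0 ≤ C := (norm_nonneg _).trans (hS 0)
        calc _ ≤ ‖C • x‖ := lp.norm_mono (by norm_num) (key x)
          _ = C * ‖x‖ := by rw [norm_smul, Real.norm_of_nonneg hC])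

/-- The translation unitary `λ_k (ξ ⊗ δ_n) = ξ ⊗ δ_{k+n}`, i.e. `(λ_k x)_n = x_{n-k}`, on
`ℓ²(ℤ, H)`. -/
def translation (k : ℤ) : ℓ²(ℤ, H) →L[ℂ] ℓ²(ℤ, H) :=
  have hp : 0 < (2 : ENNReal).toReal := by norm_num
  LinearMap.mkContinuous
    { toFun := fun x => ⟨fun n => x (n - k), memℓp_gen
        ((Equiv.subRight k).summable_iff.mpr ((lp.memℓp x).summable hp))⟩
      map_add' := fun x y => rfl
      map_smul' := fun c x => rfl } 1 (fun x => by
        rw [one_mul, lp.norm_eq_tsum_rpow hp, lp.norm_eq_tsum_rpow hp]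
        exact le_of_eq (congrArg (· ^ (1 / (2 : ENNReal).toReal))
          ((Equiv.subRight k).tsum_eq fun n => ‖x n‖ ^ (2 : ENNReal).toReal)))

/-- The diagonal operator `⨁ₙ Tₙ` of a sequence of (unbounded) operators on `H`, on its maximal
domain in `ℓ²(ℤ, H)`. -/
def directSum (T : ℤ → H →ₗ.[ℂ] H) : ℓ²(ℤ, H) →ₗ.[ℂ] ℓ²(ℤ, H) where
  domain :=
    { carrier := {x | ∃ h : ∀ n, x n ∈ (T n).domain, Memℓp (fun n => T n ⟨x n, h n⟩) 2}
      add_mem' := fun {x y} ⟨hx, hx'⟩ ⟨hy, hy'⟩ =>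
        ⟨fun n => (T n).domain.add_mem (hx n) (hy n), by
          convert hx'.add hy' using 2 with n
          exact (T n).map_add ⟨x n, hx n⟩ ⟨y n, hy n⟩⟩
      zero_mem' := ⟨fun n => (T n).domain.zero_mem, by
        convert (zero_memℓp : Memℓp (0 : ℤ → H) 2) using 2 with n
        exact (T n).map_zero⟩
      smul_mem' := fun c x ⟨hx, hx'⟩ => ⟨fun n => (T n).domain.smul_mem c (hx n), by
        convert hx'.const_smul c using 2 with n
        exact (T n).map_smul c ⟨x n, hx n⟩⟩ }
  toFun :=
    { toFun := fun x => ⟨fun n => T n ⟨x.1 n, x.2.1 n⟩, x.2.2⟩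
      map_add' := fun x y => by
        ext n
        exact (T n).map_add ⟨x.1 n, x.2.1 n⟩ ⟨y.1 n, y.2.1 n⟩
      map_smul' := fun c x => by
        ext n
        exact (T n).map_smul c ⟨x.1 n, x.2.1 n⟩ }

/-- `D ⊗ 1` on `H ⊗ ℓ²(ℤ)`. -/
def tensorOne (D : H →ₗ.[ℂ] H) : ℓ²(ℤ, H) →ₗ.[ℂ] ℓ²(ℤ, H) := directSum fun _ => D

/-- `1 ⊗ M_l` on `H ⊗ ℓ²(ℤ)`, where `M_l` is the self-adjoint operator of multiplication by the
function `l : ℤ → ℤ`. -/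
def oneTensorMul (l : ℤ → ℤ) : ℓ²(ℤ, H) →ₗ.[ℂ] ℓ²(ℤ, H) :=
  directSum fun n => ((l n : ℂ) • (LinearMap.id : H →ₗ[ℂ] H)).toPMap ⊤

/-- The Dirac operator `[[0, D ⊗ 1 - i ⊗ M_l], [D ⊗ 1 + i ⊗ M_l, 0]]` on
`(H ⊗ ℓ²(ℤ)) ⊕ (H ⊗ ℓ²(ℤ))`. -/
def crossedDirac (D : H →ₗ.[ℂ] H) (l : ℤ → ℤ) :
    WithLp 2 (ℓ²(ℤ, H) × ℓ²(ℤ, H)) →ₗ.[ℂ] WithLp 2 (ℓ²(ℤ, H) × ℓ²(ℤ, H)) :=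
  offDiagonal (tensorOne D - Complex.I • oneTensorMul (H := H) l)
    (tensorOne D + Complex.I • oneTensorMul (H := H) l)

end Operators

section CrossedProduct

variable {A H : Type*} [CStarAlgebra A] [NormedAddCommGroup H] [InnerProductSpace ℂ H]
  [CompleteSpace H]

/-- `π̃(a) (ξ ⊗ δ_n) = π(α_{-n}(a)) ξ ⊗ δ_n` on `H ⊗ ℓ²(ℤ)`. -/
def covariantRep (π : A →⋆ₐ[ℂ] (H →L[ℂ] H)) (α : Multiplicative ℤ →* (A ≃⋆ₐ[ℂ] A)) (a : A) :
    ℓ²(ℤ, H) →L[ℂ] ℓ²(ℤ, H) :=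
  diagonalOp (fun n => π (α (Multiplicative.ofAdd (-n)) a)) ‖a‖ fun n =>
    (NonUnitalStarAlgHom.norm_apply_le π _).trans
      (NonUnitalStarAlgHom.norm_apply_le (α (Multiplicative.ofAdd (-n))) a)

/-- The (reduced) crossed product `A ⋊ ℤ`, realised on `H ⊗ ℓ²(ℤ)` through a (faithful)
representation `π`: the C⋆-algebra of operators generated by `π̃(A)` and the `λ_n`. -/
def crossedProduct (π : A →⋆ₐ[ℂ] (H →L[ℂ] H)) (α : Multiplicative ℤ →* (A ≃⋆ₐ[ℂ] A)) :
    StarSubalgebra ℂ (ℓ²(ℤ, H) →L[ℂ] ℓ²(ℤ, H)) :=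
  (StarAlgebra.adjoin ℂ
    (Set.range (covariantRep π α) ∪ Set.range (translation (H := H)))).topologicalClosure

instance (π : A →⋆ₐ[ℂ] (H →L[ℂ] H)) (α : Multiplicative ℤ →* (A ≃⋆ₐ[ℂ] A)) :
    CStarAlgebra (crossedProduct π α) :=
  StarSubalgebra.cstarAlgebra _ (h_closed := StarSubalgebra.isClosed_topologicalClosure _)

/-- The set `C_c(ℤ, 𝒜)` of finite sums `∑ₙ π̃(xₙ) λₙ` with all `xₙ ∈ 𝒜`. -/
def finiteSums (π : A →⋆ₐ[ℂ] (H →L[ℂ] H)) (α : Multiplicative ℤ →* (A ≃⋆ₐ[ℂ] A))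
    (𝒜 : StarSubalgebra ℂ A) : Set (ℓ²(ℤ, H) →L[ℂ] ℓ²(ℤ, H)) :=
  {x | ∃ f : ℤ →₀ A, (∀ n, f n ∈ 𝒜) ∧ x = f.sum fun n a => covariantRep π α a * translation n}

end CrossedProduct

end

end QuantumMetric

namespace QuantumMetric

open scoped ComplexOrder InnerProductSpace ENNReal Topology
open Filter

section States

variable {A : Type*} [CStarAlgebra A]

theorem norm_state_apply_le (φ : stateSpace A) (a : A) : ‖φ.1 a‖ ≤ ‖a‖ := by
  let _ := CStarAlgebra.spectralOrder A
  let _ := CStarAlgebra.spectralOrderedRing A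
  let φ' : StrongDual ℂ A := WeakDual.toStrongDual φ.1
  let f : A →ₚ[ℂ] ℂ := PositiveLinearMap.mk₀ φ'.toLinearMap (fun x hx => by
    obtain ⟨y, rfl⟩ := CStarAlgebra.nonneg_iff_eq_star_mul_self.mp hx
    exact φ.2.2 y)
  have hf : ∀ a, f a = φ.1 a := fun _ => rfl
  have h1 : ‖f.toPreGNS 1‖ = 1 := by
    rw [PositiveLinearMap.preGNS_norm_def]
    simp [hf, φ.2.1]
  have h2 : f a = ⟪f.toPreGNS 1, f.leftMulMapPreGNS a (f.toPreGNS 1)⟫_ℂ := by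
    simp [PositiveLinearMap.preGNS_inner_def]
  calc ‖φ.1 a‖ = ‖⟪f.toPreGNS 1, f.leftMulMapPreGNS a (f.toPreGNS 1)⟫_ℂ‖ := by rw [← hf, h2]
    _ ≤ ‖f.toPreGNS 1‖ * ‖f.leftMulMapPreGNS a (f.toPreGNS 1)‖ := norm_inner_le_norm _ _
    _ ≤ ‖f.toPreGNS 1‖ * (‖a‖ * ‖f.toPreGNS 1‖) := by
        gcongr
        exact (f.leftMulMapPreGNS a).le_of_opNorm_le
          (LinearMap.mkContinuous_norm_le _ (norm_nonneg a) _) _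
    _ = ‖a‖ := by rw [h1]; ring

instance compactSpace_stateSpace : CompactSpace (stateSpace A) := by
  rw [← isCompact_iff_compactSpace]
  refine (WeakDual.isCompact_closedBall (𝕜 := ℂ) (0 : StrongDual ℂ A) 1).of_isClosed_subset ?_ ?_
  · refine IsClosed.inter (isClosed_eq (WeakDual.eval_continuous 1) continuous_const) ?_
    have : {φ : WeakDual ℂ A | ∀ a : A, 0 ≤ φ (star a * a)} =
        ⋂ a : A, {φ : WeakDual ℂ A | 0 ≤ φ (star a * a)} := by ext; simp
    change IsClosed {φ : WeakDual ℂ A | ∀ a : A, 0 ≤ φ (star a * a)}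
    rw [this]
    exact isClosed_iInter fun a => isClosed_le continuous_const (WeakDual.eval_continuous _)
  · intro φ hφ
    rw [Set.mem_preimage, mem_closedBall_zero_iff]
    refine ContinuousLinearMap.opNorm_le_bound _ zero_le_one fun a => ?_
    rw [one_mul]
    exact norm_state_apply_le ⟨φ, hφ⟩ a

variable {H : Type*} [NormedAddCommGroup H] [InnerProductSpace ℂ H]

/-- The numerical radius dominates half of the norm. -/
theorem opNorm_le_two_mul_of_inner_self_le (S : H →L[ℂ] H) {r : ℝ} (hr : 0 ≤ r)
    (h : ∀ x, ‖⟪S x, x⟫_ℂ‖ ≤ r * ‖x‖ ^ 2) : ‖S‖ ≤ 2 * r := by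
  refine S.opNorm_le_bound (by positivity) fun x => ?_
  rcases eq_or_ne (S x) 0 with h0 | h0
  · rw [h0, norm_zero]; positivity
  have hSx : 0 < ‖S x‖ := norm_pos_iff.mpr h0
  have hx : 0 < ‖x‖ := norm_pos_iff.mpr (by rintro rfl; simp at h0)
  set y : H := ((‖x‖ / ‖S x‖ : ℝ) : ℂ) • S x with hy
  have hyn : ‖y‖ = ‖x‖ := by
    rw [hy, norm_smul, Complex.norm_real, Real.norm_of_nonneg (by positivity)]
    field_simp
  have h1 : ‖⟪S x, y⟫_ℂ‖ = ‖x‖ * ‖S x‖ := by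
    rw [hy, inner_smul_right, inner_self_eq_norm_sq_to_K, norm_mul, Complex.norm_real,
      Real.norm_of_nonneg (by positivity), norm_pow, RCLike.norm_ofReal, abs_norm]
    field_simp
  have hpol := inner_map_polarization' S.toLinearMap x y
  simp only [ContinuousLinearMap.coe_coe] at hpol
  have p1 := parallelogram_law_with_norm ℂ x y
  have p2 := parallelogram_law_with_norm ℂ x (Complex.I • y)
  rw [norm_smul, Complex.norm_I, one_mul] at p2
  have key : ‖⟪S x, y⟫_ℂ‖ ≤ (r * ‖x + y‖ ^ 2 + r * ‖x - y‖ ^ 2 + r * ‖x + Complex.I • y‖ ^ 2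
      + r * ‖x - Complex.I • y‖ ^ 2) / 4 := by
    rw [hpol, norm_div, show ‖(4 : ℂ)‖ = 4 by norm_num]
    gcongr
    refine (norm_add_le _ _).trans (add_le_add ((norm_sub_le _ _).trans (add_le_add
      ((norm_sub_le _ _).trans (add_le_add (h _) (h _))) ?_)) ?_)
    · rw [norm_mul, Complex.norm_I, one_mul]; exact h _
    · rw [norm_mul, Complex.norm_I, one_mul]; exact h _
  rw [h1] at key
  rw [hyn] at p1 p2
  have : ‖x‖ * ‖S x‖ ≤ ‖x‖ * (2 * r * ‖x‖) := by nlinarith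
  exact le_of_mul_le_mul_left this hx

variable [CompleteSpace H]

theorem exists_vectorState (π : A →⋆ₐ[ℂ] (H →L[ℂ] H)) {v : H} (hv : ‖v‖ = 1) :
    ∃ φ : stateSpace A, ∀ a, φ.1 a = ⟪v, π a v⟫_ℂ := by
  let π' : A →L[ℂ] (H →L[ℂ] H) := ⟨(π : A →ₗ[ℂ] (H →L[ℂ] H)),
    AddMonoidHomClass.continuous_of_bound π 1 fun a => by simpa using NonUnitalStarAlgHom.norm_apply_le π a⟩
  refine ⟨⟨StrongDual.toWeakDual
    ((innerSL ℂ v).comp ((ContinuousLinearMap.apply ℂ H v).comp π')), ?_, fun a => ?_⟩,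
    fun a => rfl⟩
  · change ⟪v, π 1 v⟫_ℂ = 1
    simp [hv]
  · change 0 ≤ ⟪v, π (star a * a) v⟫_ℂ
    rw [map_mul, map_star, ContinuousLinearMap.star_eq_adjoint, mul_apply_eq_comp,
      ContinuousLinearMap.adjoint_inner_right, inner_self_eq_norm_sq_to_K]
    norm_cast
    positivity

theorem norm_le_two_mul_of_state_le (π : A →⋆ₐ[ℂ] (H →L[ℂ] H)) (hπ : Function.Injective π)
    (a : A) {r : ℝ} (hr : 0 ≤ r) (h : ∀ φ : stateSpace A, ‖φ.1 a‖ ≤ r) : ‖a‖ ≤ 2 * r := by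
  rw [← NonUnitalStarAlgHom.norm_map π hπ a]
  refine opNorm_le_two_mul_of_inner_self_le _ hr fun x => ?_
  rcases eq_or_ne x 0 with rfl | hx
  · simp
  have hx' : 0 < ‖x‖ := norm_pos_iff.mpr hx
  set v : H := ((‖x‖⁻¹ : ℝ) : ℂ) • x with hv
  have hvn : ‖v‖ = 1 := by
    rw [hv, norm_smul, Complex.norm_real, norm_inv, norm_norm, inv_mul_cancel₀ hx'.ne']
  have hxv : x = ((‖x‖ : ℝ) : ℂ) • v := by
    rw [hv, smul_smul, ← Complex.ofReal_mul, mul_inv_cancel₀ hx'.ne', Complex.ofReal_one, one_smul]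
  obtain ⟨φ, hφ⟩ := exists_vectorState π hvn
  have h1 := h φ
  rw [hφ, norm_inner_symm] at h1
  rw [hxv, map_smul, inner_smul_left, inner_smul_right, norm_mul, norm_mul, ← hxv,
    RCLike.norm_conj, Complex.norm_real, norm_norm]
  calc _ = ‖⟪π a v, v⟫_ℂ‖ * ‖x‖ ^ 2 := by ring
    _ ≤ _ := by gcongr

end States

section LipMetric

variable {A : Type*} [CStarAlgebra A] {𝒜 : StarSubalgebra ℂ A} {L : 𝒜 → ℝ}

theorem edist_state_le_stateDist (φ ψ : stateSpace A) {a : 𝒜} (ha : L a ≤ 1) :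
    edist (φ.1 (a : A)) (ψ.1 (a : A)) ≤ stateDist 𝒜 L φ ψ :=
  le_iSup₂ (f := fun (a : 𝒜) (_ : L a ≤ 1) => edist (φ.1 (a : A)) (ψ.1 (a : A))) a ha

theorem norm_state_sub_le (φ ψ : stateSpace A) {a : 𝒜} (ha : L a ≤ 1) {r : ℝ} (hr : 0 ≤ r)
    (h : stateDist 𝒜 L φ ψ ≤ ENNReal.ofReal r) : ‖φ.1 (a : A) - ψ.1 (a : A)‖ ≤ r := by
  have := (edist_state_le_stateDist φ ψ ha).trans h
  rwa [edist_dist, ENNReal.ofReal_le_ofReal_iff hr, dist_eq_norm] at this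

/-- In a compact quantum metric space, the Lipschitz ball is totally bounded modulo scalars. -/
theorem InducesLipMetric.totallyBounded {H : Type*} [NormedAddCommGroup H]
    [InnerProductSpace ℂ H] [CompleteSpace H] (h : InducesLipMetric 𝒜 L)
    (π : A →⋆ₐ[ℂ] (H →L[ℂ] H)) (hπ : Function.Injective π) (φ₀ : stateSpace A) :
    TotallyBounded ((fun a : 𝒜 => (a : A) - φ₀.1 (a : A) • (1 : A)) '' {a | L a ≤ 1}) := by
  obtain ⟨m, hm, ht⟩ := h
  have hfin : ∀ φ ψ : stateSpace A, stateDist 𝒜 L φ ψ ≠ ⊤ := fun φ ψ => by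
    rw [← hm]; exact @edist_ne_top _ m.toPseudoMetricSpace φ ψ
  have hnet : ∀ ε > (0 : ℝ), ∃ t : Set (stateSpace A), t.Finite ∧
      ∀ φ, ∃ ψ ∈ t, stateDist 𝒜 L φ ψ ≤ ENNReal.ofReal ε := by
    intro ε hε
    have hc : @CompactSpace _ m.toPseudoMetricSpace.toUniformSpace.toTopologicalSpace := by
      rw [ht]; infer_instance
    obtain ⟨t, -, htf, hts⟩ := @finite_cover_balls_of_compact _ m.toPseudoMetricSpace
      Set.univ (@isCompact_univ _ (_) hc) ε hε
    refine ⟨t, htf, fun φ => ?_⟩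
    obtain ⟨ψ, hψ, hd⟩ := Set.mem_iUnion₂.mp (hts (Set.mem_univ φ))
    refine ⟨ψ, hψ, ?_⟩
    rw [← hm]
    exact (@edist_dist _ m.toPseudoMetricSpace φ ψ).trans_le (ENNReal.ofReal_le_ofReal hd.le)
  refine Metric.totallyBounded_of_finite_discretization fun ε hε => ?_
  obtain ⟨t, htf, ht⟩ := hnet (ε / 12) (by positivity)
  have : Fintype t := htf.fintype
  let Θ : 𝒜 → (t → ℂ) := fun a ψ => ψ.1.1 (a : A) - φ₀.1 (a : A)
  have hΘ : TotallyBounded (Θ '' {a | L a ≤ 1}) := by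
    refine TotallyBounded.subset subset_closure
      (Bornology.IsBounded.isCompact_closure ?_).totallyBounded
    rw [isBounded_iff_forall_norm_le]
    refine ⟨∑ ψ : t, (stateDist 𝒜 L ψ.1 φ₀).toReal, ?_⟩
    rintro _ ⟨a, ha, rfl⟩
    refine (pi_norm_le_iff_of_nonneg (Finset.sum_nonneg fun _ _ => ENNReal.toReal_nonneg)).mpr
      fun ψ => ?_
    refine (norm_state_sub_le ψ.1 φ₀ ha ENNReal.toReal_nonneg
      (ENNReal.ofReal_toReal (hfin _ _)).ge).trans ?_
    exact Finset.single_le_sum (f := fun ψ : t => (stateDist 𝒜 L ψ.1 φ₀).toReal)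
      (fun _ _ => ENNReal.toReal_nonneg) (Finset.mem_univ ψ)
  obtain ⟨s, hsf, hs⟩ := Metric.totallyBounded_iff.mp hΘ (ε / 24) (by positivity)
  have : Fintype s := hsf.fintype
  have hch : ∀ x : ((fun a : 𝒜 => (a : A) - φ₀.1 (a : A) • (1 : A)) '' {a | L a ≤ 1} : Set A),
      ∃ (a : 𝒜) (z : s), L a ≤ 1 ∧ (a : A) - φ₀.1 (a : A) • (1 : A) = x ∧
        dist (Θ a) z < ε / 24 := by
    rintro ⟨_, a, ha, rfl⟩
    obtain ⟨z, hz, hd⟩ := Set.mem_iUnion₂.mp (hs ⟨a, ha, rfl⟩)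
    exact ⟨a, ⟨z, hz⟩, ha, rfl, hd⟩
  choose a z ha hax hz using hch
  refine ⟨s, inferInstance, z, fun x y hxy => ?_⟩
  have hd : ‖Θ (a x) - Θ (a y)‖ ≤ ε / 12 := by
    have h1 := hz x
    have h2 := hz y
    rw [← hxy] at h2
    rw [← dist_eq_norm]
    linarith [dist_triangle_right (Θ (a x)) (Θ (a y)) (z x : t → ℂ)]
  have hst : ∀ φ : stateSpace A, ‖φ.1 ((x : A) - y)‖ ≤ ε / 4 := by
    intro φ
    obtain ⟨ψ, hψ, hφψ⟩ := ht φ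
    have h1 := norm_state_sub_le φ ψ (ha x) (by positivity) hφψ
    have h2 := norm_state_sub_le φ ψ (ha y) (by positivity) hφψ
    have h3 := (norm_le_pi_norm (Θ (a x) - Θ (a y)) ⟨ψ, hψ⟩).trans hd
    have e : φ.1 ((x : A) - y) = (φ.1 (a x : A) - ψ.1 (a x : A)) - (φ.1 (a y : A) - ψ.1 (a y : A))
        + (Θ (a x) - Θ (a y)) ⟨ψ, hψ⟩ := by
      rw [← hax x, ← hax y]
      simp only [map_sub, map_smul, φ.2.1, smul_eq_mul, mul_one, Pi.sub_apply, Θ]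
      ring
    rw [e]
    calc _ ≤ ε / 12 + ε / 12 + ε / 12 :=
          (norm_add_le _ _).trans (add_le_add ((norm_sub_le _ _).trans (add_le_add h1 h2)) h3)
      _ = ε / 4 := by ring
  rw [dist_eq_norm]
  linarith [norm_le_two_mul_of_state_le π hπ _ (by positivity) hst]

/-- A seminorm on a dense subalgebra whose unit ball is totally bounded modulo scalars induces a
Lip-metric. -/
theorem InducesLipMetric.of_totallyBounded (hd : Dense (𝒜 : Set A))
    (hL : ∀ (c : ℂ) (a : 𝒜), L (c • a) ≤ ‖c‖ * L a)
    (hK : ∀ ε > (0 : ℝ), ∃ K : Set A, TotallyBounded K ∧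
      ∀ a : 𝒜, L a ≤ 1 → ∃ y ∈ K, ∃ c : ℂ, ‖(a : A) - y - c • 1‖ ≤ ε) :
    InducesLipMetric 𝒜 L := by
  have hsub : ∀ {ε : ℝ} {x y : A} {c : ℂ}, ‖x - y - c • 1‖ ≤ ε → ∀ φ ψ : stateSpace A,
      ‖φ.1 x - ψ.1 x‖ ≤ 2 * ε + ‖φ.1 y - ψ.1 y‖ := by
    intro ε x y c h φ ψ
    have h1 := (norm_state_apply_le φ _).trans h
    have h2 := (norm_state_apply_le ψ _).trans h
    have e : φ.1 x - ψ.1 x = φ.1 (x - y - c • 1) - ψ.1 (x - y - c • 1) + (φ.1 y - ψ.1 y) := by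
      simp only [map_sub, map_smul, φ.2.1, ψ.2.1]
      ring
    rw [e, two_mul]
    exact (norm_add_le _ _).trans (add_le_add_left ((norm_sub_le _ _).trans (add_le_add h1 h2)) _)
  have hle : ∀ {φ ψ : stateSpace A} {r : ℝ}, (∀ a : 𝒜, L a ≤ 1 → ‖φ.1 (a : A) - ψ.1 (a : A)‖ ≤ r) →
      stateDist 𝒜 L φ ψ ≤ ENNReal.ofReal r := fun h => iSup₂_le fun a ha => by
    rw [edist_dist, dist_eq_norm]
    exact ENNReal.ofReal_le_ofReal (h a ha)
  have hfin : ∀ φ ψ : stateSpace A, stateDist 𝒜 L φ ψ ≠ ⊤ := by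
    intro φ ψ
    obtain ⟨K, hKt, hKa⟩ := hK 1 one_pos
    obtain ⟨R, hR⟩ := isBounded_iff_forall_norm_le.mp hKt.isBounded
    refine ne_top_of_le_ne_top ENNReal.ofReal_ne_top (hle (r := 2 * 1 + (R + R)) fun a ha => ?_)
    obtain ⟨y, hy, c, hc⟩ := hKa a ha
    refine (hsub hc φ ψ).trans (add_le_add_right ((norm_sub_le _ _).trans (add_le_add ?_ ?_)) _)
    · exact (norm_state_apply_le φ y).trans (hR y hy)
    · exact (norm_state_apply_le ψ y).trans (hR y hy)
  have hweak : ∀ (φ : stateSpace A) (ε : ℝ), 0 < ε →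
      ∀ᶠ ψ in 𝓝 φ, stateDist 𝒜 L ψ φ ≤ ENNReal.ofReal ε := by
    intro φ ε hε
    obtain ⟨K, hKt, hKa⟩ := hK (ε / 8) (by positivity)
    obtain ⟨F, hF, hFK⟩ := Metric.totallyBounded_iff.mp hKt (ε / 8) (by positivity)
    have hev : ∀ᶠ ψ : stateSpace A in 𝓝 φ, ∀ y ∈ F, ‖ψ.1 y - φ.1 y‖ < ε / 2 := by
      refine (eventually_all_finite hF).mpr fun y _ => ?_
      have hc : Continuous fun ψ : stateSpace A => ‖ψ.1 y - φ.1 y‖ :=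
        (((WeakDual.eval_continuous y).comp continuous_subtype_val).sub continuous_const).norm
      refine hc.continuousAt.eventually_lt continuousAt_const ?_
      simpa using half_pos hε
    filter_upwards [hev] with ψ hψ
    refine hle fun a ha => ?_
    obtain ⟨y, hy, c, hc⟩ := hKa a ha
    obtain ⟨z, hz, hyz⟩ := Set.mem_iUnion₂.mp (hFK hy)
    have hz' : ‖(a : A) - z - c • 1‖ ≤ ε / 4 := by
      have : (a : A) - z - c • 1 = ((a : A) - y - c • 1) + (y - z) := by abel
      rw [this]
      rw [Metric.mem_ball, dist_eq_norm] at hyz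
      linarith [norm_add_le ((a : A) - y - c • 1) (y - z)]
    linarith [hsub hz' ψ φ, hψ z hz]
  have hsep : ∀ (x : A) (ε : ℝ), 0 < ε → ∃ δ : ℝ≥0∞, 0 < δ ∧ ∀ φ ψ : stateSpace A,
      stateDist 𝒜 L φ ψ < δ → dist (φ.1 x) (ψ.1 x) < ε := by
    intro x ε hε
    obtain ⟨a, ha, hxa⟩ := Metric.mem_closure_iff.mp (hd x) (ε / 4) (by positivity)
    set t : ℝ := |L ⟨a, ha⟩| + 1 with ht
    have htp : 0 < t := by positivity
    refine ⟨ENNReal.ofReal (ε / 2 / t), by simpa using by positivity, fun φ ψ h => ?_⟩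
    have hLt : L ((t⁻¹ : ℂ) • ⟨a, ha⟩) ≤ 1 := by
      refine (hL _ _).trans ?_
      rw [norm_inv, Complex.norm_real, Real.norm_of_nonneg htp.le, inv_mul_le_one₀ htp]
      linarith [le_abs_self (L ⟨a, ha⟩)]
    have h1 := norm_state_sub_le φ ψ hLt (by positivity) h.le
    have e : ((((t⁻¹ : ℂ) • (⟨a, ha⟩ : 𝒜) : 𝒜)) : A) = (t⁻¹ : ℂ) • a := rfl
    rw [e, map_smul, map_smul, ← smul_sub, norm_smul, norm_inv, Complex.norm_real,
      Real.norm_of_nonneg htp.le, inv_mul_eq_div, div_le_div_iff_of_pos_right htp] at h1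
    have hx : ‖x - a - (0 : ℂ) • 1‖ ≤ ‖x - a‖ := by simp
    rw [dist_eq_norm] at hxa ⊢
    linarith [hsub hx φ ψ]
  let E : EMetricSpace (stateSpace A) :=
    { edist := stateDist 𝒜 L
      edist_self := fun φ => by simp [stateDist]
      edist_comm := fun φ ψ => by simp [stateDist, edist_comm]
      edist_triangle := fun φ ψ χ => iSup₂_le fun a ha => (edist_triangle _ (ψ.1 (a : A)) _).trans
        (add_le_add (edist_state_le_stateDist φ ψ ha) (edist_state_le_stateDist ψ χ ha))
      eq_of_edist_eq_zero := fun {φ ψ} h => by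
        refine Subtype.ext (DFunLike.ext _ _ fun x => eq_of_forall_dist_le fun ε hε => ?_)
        obtain ⟨δ, hδ, hx⟩ := hsep x ε hε
        exact (hx φ ψ (h.trans_lt hδ)).le }
  refine ⟨@EMetricSpace.toMetricSpace _ E hfin, fun φ ψ => rfl, le_antisymm ?_ ?_⟩
  · let _ : TopologicalSpace (stateSpace A) :=
      E.toPseudoEMetricSpace.toUniformSpace.toTopologicalSpace
    refine continuous_iff_le_induced.mp (WeakDual.continuous_of_continuous_eval fun x => ?_)
    refine continuous_iff_continuousAt.mpr fun φ => Metric.tendsto_nhds.mpr fun ε hε => ?_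
    obtain ⟨δ, hδ, hx⟩ := hsep x ε hε
    filter_upwards [Metric.eball_mem_nhds φ hδ] with ψ hψ using hx ψ φ hψ
  · refine continuous_id_iff_le.mp ?_
    refine (@continuous_iff_continuousAt _ _ _ (_) _).mpr fun φ => ?_
    refine (@EMetric.tendsto_nhds _ _ E.toPseudoEMetricSpace _ _ _).mpr fun ε hε => ?_
    obtain ⟨r, hr, hrε⟩ := ENNReal.lt_iff_exists_real_btwn.mp hε
    filter_upwards [hweak φ r (by simpa using hrε.1)] with ψ hψ using hψ.trans_lt hrε.2

end LipMetric

section Operators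

variable {H : Type*} [NormedAddCommGroup H] [InnerProductSpace ℂ H]

theorem translation_apply (k : ℤ) (x : ℓ²(ℤ, H)) (n : ℤ) : translation k x n = x (n - k) := rfl

theorem translation_zero : translation (H := H) 0 = 1 := by
  ext x n
  simp [translation_apply]

theorem translation_mul_translation (m n : ℤ) :
    translation (H := H) m * translation n = translation (m + n) := by
  ext x k
  simp only [mul_apply_eq_comp, translation_apply, sub_sub]

theorem star_translation [CompleteSpace H] (n : ℤ) :
    star (translation (H := H) n) = translation (-n) := by
  rw [ContinuousLinearMap.star_eq_adjoint, eq_comm, ContinuousLinearMap.eq_adjoint_iff]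
  intro x y
  rw [lp.inner_eq_tsum, lp.inner_eq_tsum, ← (Equiv.subRight n).tsum_eq]
  refine tsum_congr fun k => ?_
  simp [translation_apply]

end Operators

section CrossedProduct

variable {A H : Type*} [CStarAlgebra A] [NormedAddCommGroup H] [InnerProductSpace ℂ H]
  [CompleteSpace H] (π : A →⋆ₐ[ℂ] (H →L[ℂ] H)) (α : Multiplicative ℤ →* (A ≃⋆ₐ[ℂ] A))

theorem covariantRep_apply (a : A) (x : ℓ²(ℤ, H)) (n : ℤ) :
    covariantRep π α a x n = π (α (Multiplicative.ofAdd (-n)) a) (x n) := rfl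

/-- The covariant representation as a ⋆-homomorphism. -/
noncomputable def covariantHom : A →⋆ₐ[ℂ] (ℓ²(ℤ, H) →L[ℂ] ℓ²(ℤ, H)) where
  toFun := covariantRep π α
  map_one' := by ext x n; simp [covariantRep_apply]
  map_mul' a b := by ext x n; simp [covariantRep_apply]
  map_zero' := by ext x n; simp [covariantRep_apply]
  map_add' a b := by ext x n; simp [covariantRep_apply]
  commutes' c := by
    ext x n
    simp [covariantRep_apply, Algebra.algebraMap_eq_smul_one]
  map_star' a := by
    rw [ContinuousLinearMap.star_eq_adjoint, ContinuousLinearMap.eq_adjoint_iff]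
    intro x y
    rw [lp.inner_eq_tsum, lp.inner_eq_tsum]
    refine tsum_congr fun n => ?_
    simp only [covariantRep_apply, map_star, ContinuousLinearMap.star_eq_adjoint,
      ContinuousLinearMap.adjoint_inner_left]

theorem covariantHom_apply (a : A) : covariantHom π α a = covariantRep π α a := rfl

theorem translation_mul_covariantRep (n : ℤ) (a : A) :
    translation n * covariantRep π α a =
      covariantRep π α (α (Multiplicative.ofAdd n) a) * translation n := by
  ext x k
  simp only [mul_apply_eq_comp, translation_apply, covariantRep_apply]
  rw [← StarAlgEquiv.mul_apply, ← map_mul, ← ofAdd_add, neg_sub, sub_eq_neg_add]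

theorem monomial_mul_monomial (a b : A) (m n : ℤ) :
    covariantRep π α a * translation m * (covariantRep π α b * translation n) =
      covariantRep π α (a * α (Multiplicative.ofAdd m) b) * translation (m + n) := by
  rw [mul_assoc, ← mul_assoc (translation m), translation_mul_covariantRep, mul_assoc,
    translation_mul_translation, ← mul_assoc, ← covariantHom_apply, ← covariantHom_apply, ← map_mul]
  rfl

theorem star_monomial (a : A) (n : ℤ) :
    star (covariantRep π α a * translation n) =
      covariantRep π α (α (Multiplicative.ofAdd (-n)) (star a)) * translation (-n) := by
  rw [star_mul, star_translation, ← covariantHom_apply, ← map_star, covariantHom_apply,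
    translation_mul_covariantRep]

variable {π α} {𝒜 : StarSubalgebra ℂ A}

theorem monomial_mem_finiteSums {a : A} (ha : a ∈ 𝒜) (n : ℤ) :
    covariantRep π α a * translation n ∈ finiteSums π α 𝒜 := by
  refine ⟨Finsupp.single n a, fun m => ?_, ?_⟩
  · rw [Finsupp.single_apply]
    split_ifs
    exacts [ha, zero_mem 𝒜]
  · rw [Finsupp.sum_single_index]
    rw [← covariantHom_apply, map_zero, zero_mul]

theorem add_mem_finiteSums {x y : ℓ²(ℤ, H) →L[ℂ] ℓ²(ℤ, H)} (hx : x ∈ finiteSums π α 𝒜)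
    (hy : y ∈ finiteSums π α 𝒜) : x + y ∈ finiteSums π α 𝒜 := by
  obtain ⟨f, hf, rfl⟩ := hx
  obtain ⟨g, hg, rfl⟩ := hy
  refine ⟨f + g, fun n => add_mem (hf n) (hg n), ?_⟩
  rw [Finsupp.sum_add_index']
  · intro n; rw [← covariantHom_apply, map_zero, zero_mul]
  · intro n a b; rw [← covariantHom_apply, map_add, add_mul]; rfl

theorem finiteSums_induction {P : (ℓ²(ℤ, H) →L[ℂ] ℓ²(ℤ, H)) → Prop} (h0 : P 0)
    (hadd : ∀ x y, P x → P y → P (x + y))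
    (hmon : ∀ a ∈ 𝒜, ∀ n, P (covariantRep π α a * translation n))
    {x : ℓ²(ℤ, H) →L[ℂ] ℓ²(ℤ, H)} (hx : x ∈ finiteSums π α 𝒜) : P x := by
  obtain ⟨f, hf, rfl⟩ := hx
  exact Finset.sum_induction _ P hadd h0 fun n _ => hmon _ (hf n) n

theorem zero_mem_finiteSums : (0 : ℓ²(ℤ, H) →L[ℂ] ℓ²(ℤ, H)) ∈ finiteSums π α 𝒜 :=
  ⟨0, fun _ => zero_mem 𝒜, by simp⟩

variable (π) in
/-- The ⋆-subalgebra `C_c(ℤ, 𝒜)` of operators, for an invariant ⋆-subalgebra `𝒜`. -/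
noncomputable def finiteSumsSubalgebra (h𝒜 : ∀ g, ∀ a ∈ 𝒜, α g a ∈ 𝒜) :
    StarSubalgebra ℂ (ℓ²(ℤ, H) →L[ℂ] ℓ²(ℤ, H)) where
  carrier := finiteSums π α 𝒜
  add_mem' := add_mem_finiteSums
  zero_mem' := zero_mem_finiteSums
  mul_mem' {x y} hx hy := by
    refine finiteSums_induction (P := fun x => x * y ∈ finiteSums π α 𝒜) ?_ ?_ ?_ hx
    · rw [zero_mul]; exact zero_mem_finiteSums
    · intro x x' hx hx'
      rw [add_mul]; exact add_mem_finiteSums hx hx'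
    · intro a ha m
      refine finiteSums_induction
        (P := fun y => covariantRep π α a * translation m * y ∈ finiteSums π α 𝒜) ?_ ?_ ?_ hy
      · rw [mul_zero]; exact zero_mem_finiteSums
      · intro x x' hx hx'
        rw [mul_add]; exact add_mem_finiteSums hx hx'
      · intro b hb n
        rw [monomial_mul_monomial]
        exact monomial_mem_finiteSums (mul_mem ha (h𝒜 _ _ hb)) _
  one_mem' := by
    have := monomial_mem_finiteSums (π := π) (α := α) (one_mem 𝒜) 0
    rwa [← covariantHom_apply, map_one, one_mul, translation_zero] at this
  algebraMap_mem' c := by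
    have := monomial_mem_finiteSums (π := π) (α := α) (algebraMap_mem 𝒜 c) 0
    rwa [← covariantHom_apply, AlgHomClass.commutes, translation_zero, mul_one] at this
  star_mem' {x} hx := by
    refine finiteSums_induction (P := fun x : ℓ²(ℤ, H) →L[ℂ] ℓ²(ℤ, H) => star x ∈ finiteSums π α 𝒜)
      ?_ ?_ ?_ hx
    · rw [star_zero]; exact zero_mem_finiteSums
    · intro x x' hx hx'
      rw [star_add]; exact add_mem_finiteSums hx hx'
    · intro a ha n
      rw [star_monomial]
      exact monomial_mem_finiteSums (h𝒜 _ _ (star_mem ha)) _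

theorem continuous_covariantRep : Continuous (covariantRep π α) :=
  AddMonoidHomClass.continuous_of_bound (covariantHom π α) 1
    fun a => by simpa using NonUnitalStarAlgHom.norm_apply_le (covariantHom π α) a

theorem monomial_mem_crossedProduct (a : A) (n : ℤ) :
    covariantRep π α a * translation n ∈ crossedProduct π α :=
  StarSubalgebra.le_topologicalClosure _ (mul_mem
    (StarAlgebra.subset_adjoin _ _ (Or.inl ⟨a, rfl⟩))
    (StarAlgebra.subset_adjoin _ _ (Or.inr ⟨n, rfl⟩)))

theorem finiteSums_subset_crossedProduct :
    finiteSums π α 𝒜 ⊆ (crossedProduct π α : Set (ℓ²(ℤ, H) →L[ℂ] ℓ²(ℤ, H))) := fun _ hx =>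
  finiteSums_induction (P := fun x => x ∈ crossedProduct π α) (zero_mem _)
    (fun _ _ => add_mem) (fun a _ n => monomial_mem_crossedProduct a n) hx

theorem crossedProduct_le_topologicalClosure (h𝒜 : ∀ g, ∀ a ∈ 𝒜, α g a ∈ 𝒜)
    (hd : Dense (𝒜 : Set A)) :
    crossedProduct π α ≤ (finiteSumsSubalgebra π h𝒜).topologicalClosure := by
  refine StarSubalgebra.topologicalClosure_minimal (StarAlgebra.adjoin_le ?_)
    (StarSubalgebra.isClosed_topologicalClosure _)
  rintro _ (⟨a, rfl⟩ | ⟨n, rfl⟩)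
  · refine map_mem_closure continuous_covariantRep (hd a) fun b hb => ?_
    have := monomial_mem_finiteSums (π := π) (α := α) hb 0
    rwa [translation_zero, mul_one] at this
  · refine subset_closure ?_
    have := monomial_mem_finiteSums (π := π) (α := α) (one_mem 𝒜) n
    rwa [← covariantHom_apply, map_one, one_mul] at this

theorem dense_finiteSums (h𝒜 : ∀ g, ∀ a ∈ 𝒜, α g a ∈ 𝒜) (hd : Dense (𝒜 : Set A)) :
    Dense {x : crossedProduct π α | (x : ℓ²(ℤ, H) →L[ℂ] ℓ²(ℤ, H)) ∈ finiteSums π α 𝒜} := by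
  intro x
  rw [closure_subtype]
  have hx := crossedProduct_le_topologicalClosure h𝒜 hd x.2
  refine closure_mono (fun y hy => ?_) hx
  exact ⟨⟨y, finiteSums_subset_crossedProduct hy⟩, hy, rfl⟩

theorem separableSpace_crossedProduct [TopologicalSpace.SeparableSpace A] :
    TopologicalSpace.SeparableSpace (crossedProduct π α) := by
  let V := Submodule.span ℂ (⋃ n : ℤ,
    Set.range fun a => covariantRep π α a * translation n)
  have hV : TopologicalSpace.IsSeparable (V : Set (ℓ²(ℤ, H) →L[ℂ] ℓ²(ℤ, H))) :=
    TopologicalSpace.IsSeparable.span (.iUnion fun n =>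
      TopologicalSpace.isSeparable_range (continuous_covariantRep.mul continuous_const))
  refine (hV.closure.mono fun x hx => ?_).separableSpace
  refine closure_mono (fun y hy => ?_)
    (crossedProduct_le_topologicalClosure (𝒜 := ⊤) (fun _ _ _ => StarSubalgebra.mem_top)
      (by simp) hx)
  refine finiteSums_induction (P := fun y => y ∈ V) (zero_mem _) (fun _ _ => add_mem)
    (fun a _ n => Submodule.subset_span (Set.mem_iUnion.mpr ⟨n, a, rfl⟩)) hy

end CrossedProduct

section Unbounded

variable {H : Type*} [NormedAddCommGroup H] [InnerProductSpace ℂ H]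

theorem LinearPMap.apply_congr {E F : Type*} [AddCommGroup E] [Module ℂ E] [AddCommGroup F]
    [Module ℂ F] (f : E →ₗ.[ℂ] F) {x y : E} (h : x = y) (hx : x ∈ f.domain) (hy : y ∈ f.domain) :
    f ⟨x, hx⟩ = f ⟨y, hy⟩ := by subst h; rfl

theorem memℓp_two_iff {H : Type*} [NormedAddCommGroup H] {ι : Type*} {f : ι → H} :
    Memℓp f 2 ↔ Summable fun i => ‖f i‖ ^ 2 := by
  rw [memℓp_gen_iff (by norm_num)]
  simp

theorem lp_hasSum_norm_sq {ι : Type*} {H : Type*} [NormedAddCommGroup H] (x : ℓ²(ι, H)) :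
    HasSum (fun i => ‖x i‖ ^ 2) (‖x‖ ^ 2) := by
  have := lp.hasSum_norm (p := 2) (by norm_num) x
  simpa using this

theorem ExtendsCommutator.unique {D : H →ₗ.[ℂ] H} (hd : Dense (D.domain : Set H))
    {T S S' : H →L[ℂ] H} (h : ExtendsCommutator D T S) (h' : ExtendsCommutator D T S') :
    S = S' := by
  refine ContinuousLinearMap.ext fun x => congrFun (Continuous.ext_on hd S.continuous S'.continuous
    fun y hy => ?_) x
  obtain ⟨_, h1⟩ := h ⟨y, hy⟩
  obtain ⟨_, h2⟩ := h' ⟨y, hy⟩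
  exact h1.symm.trans h2

theorem ExtendsCommutator.zero (D : H →ₗ.[ℂ] H) : ExtendsCommutator D 0 0 := fun x => by
  refine ⟨zero_mem _, ?_⟩
  change D 0 - 0 = 0
  rw [D.map_zero, sub_zero]

theorem ExtendsCommutator.add {D : H →ₗ.[ℂ] H} {T T' S S' : H →L[ℂ] H}
    (h : ExtendsCommutator D T S) (h' : ExtendsCommutator D T' S') :
    ExtendsCommutator D (T + T') (S + S') := fun x => by
  obtain ⟨m, e⟩ := h x
  obtain ⟨m', e'⟩ := h' x
  refine ⟨add_mem m m', ?_⟩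
  change D (⟨T x, m⟩ + ⟨T' x, m'⟩) - (T (D x) + T' (D x)) = S x + S' x
  rw [D.map_add, ← e, ← e']
  abel

theorem ExtendsCommutator.mul {D : H →ₗ.[ℂ] H} {T T' S S' : H →L[ℂ] H}
    (h : ExtendsCommutator D T S) (h' : ExtendsCommutator D T' S') :
    ExtendsCommutator D (T * T') (S * T' + T * S') := fun x => by
  obtain ⟨m', e'⟩ := h' x
  obtain ⟨m, e⟩ := h ⟨T' x, m'⟩
  refine ⟨m, ?_⟩
  change D ⟨T (T' x), m⟩ - T (T' (D x)) = S (T' x) + T (S' x)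
  rw [← e, ← e', map_sub]
  abel

/-- The operator `D ⊗ 1 + τ ⊗ M_ι` on `H ⊗ ℓ²(ℤ)`. -/
noncomputable def shiftedDirac (D : H →ₗ.[ℂ] H) (τ : ℂ) : ℓ²(ℤ, H) →ₗ.[ℂ] ℓ²(ℤ, H) :=
  tensorOne D + τ • oneTensorMul (H := H) id

theorem tensorOne_sub_smul (D : H →ₗ.[ℂ] H) (τ : ℂ) :
    tensorOne D - τ • oneTensorMul (H := H) id = shiftedDirac D (-τ) := by
  refine LinearPMap.ext rfl fun x h h' => ?_
  change tensorOne D ⟨x, h.1⟩ - τ • oneTensorMul id ⟨x, h.2⟩ =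
    tensorOne D ⟨x, h.1⟩ + (-τ) • oneTensorMul id ⟨x, h.2⟩
  rw [neg_smul, sub_eq_add_neg]

variable {D : H →ₗ.[ℂ] H} {τ : ℂ}

theorem mem_shiftedDirac_domain {x : ℓ²(ℤ, H)} : x ∈ (shiftedDirac D τ).domain ↔
    ∃ h : ∀ n, x n ∈ D.domain, Memℓp (fun n => D ⟨x n, h n⟩) 2 ∧
      Memℓp (fun n : ℤ => (n : ℂ) • x n) 2 :=
  ⟨fun ⟨⟨h, h1⟩, ⟨_, h2⟩⟩ => ⟨h, h1, h2⟩, fun ⟨h, h1, h2⟩ => ⟨⟨h, h1⟩, ⟨fun _ => trivial, h2⟩⟩⟩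

theorem shiftedDirac_apply (x : (shiftedDirac D τ).domain) (n : ℤ) (h : x.1 n ∈ D.domain) :
    shiftedDirac D τ x n = D ⟨x.1 n, h⟩ + (τ * n) • x.1 n := by
  rw [mul_smul]
  rfl

theorem single_mem_shiftedDirac_domain {v : H} (hv : v ∈ D.domain) (n : ℤ) :
    lp.single 2 n v ∈ (shiftedDirac D τ).domain := by
  have h : ∀ m, lp.single (E := fun _ : ℤ => H) 2 n v m ∈ D.domain := fun m => by
    rw [lp.single_apply, Pi.single_apply]
    split_ifs
    exacts [hv, zero_mem _]
  have h0 : ∀ m, m ≠ n → lp.single (E := fun _ : ℤ => H) 2 n v m = 0 := fun m hm =>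
    lp.single_apply_ne _ _ _ hm
  refine mem_shiftedDirac_domain.mpr ⟨h, memℓp_two_iff.mpr ?_, memℓp_two_iff.mpr ?_⟩
  · refine summable_of_ne_finset_zero (s := {n}) fun m hm => ?_
    rw [LinearPMap.apply_congr D (h0 m (by simpa using hm)) _ (zero_mem _)]
    have : D ⟨0, zero_mem _⟩ = 0 := D.map_zero
    simp [this]
  · refine summable_of_ne_finset_zero (s := {n}) fun m hm => ?_
    rw [h0 m (by simpa using hm)]
    simp

theorem dense_shiftedDirac_domain [CompleteSpace H] (hd : Dense (D.domain : Set H)) :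
    Dense ((shiftedDirac D τ).domain : Set ℓ²(ℤ, H)) := by
  rw [Submodule.dense_iff_topologicalClosure_eq_top,
    Submodule.topologicalClosure_eq_top_iff, Submodule.eq_bot_iff]
  intro x hx
  ext n
  refine hd.eq_zero_of_inner_left (𝕜 := ℂ) (x := x n) fun v hv => ?_
  have := (Submodule.mem_orthogonal _ _).mp hx _ (single_mem_shiftedDirac_domain hv n)
  rw [lp.inner_single_left] at this
  rw [← inner_conj_symm, this, map_zero]

theorem norm_sq_add_imaginary_smul (hsym : ∀ x y : D.domain, ⟪D x, (y : H)⟫_ℂ = ⟪(x : H), D y⟫_ℂ)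
    (hτ : star τ = -τ) (x : D.domain) (n : ℤ) :
    ‖D x + (τ * n) • (x : H)‖ ^ 2 = ‖D x‖ ^ 2 + ‖τ‖ ^ 2 * (n : ℝ) ^ 2 * ‖(x : H)‖ ^ 2 := by
  rw [norm_add_sq (𝕜 := ℂ), inner_smul_right, norm_smul, norm_mul, Complex.norm_intCast]
  have h1 : (τ * n * ⟪D x, (x : H)⟫_ℂ).re = 0 := by
    have hreal : (starRingEnd ℂ) ⟪D x, (x : H)⟫_ℂ = ⟪D x, (x : H)⟫_ℂ := by
      rw [inner_conj_symm, hsym]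
    obtain ⟨r, hr⟩ := Complex.conj_eq_iff_real.mp hreal
    have hτre : τ.re = 0 := by
      have := congrArg Complex.re hτ
      simp at this
      linarith
    rw [hr]
    simp [hτre]
  change _ + 2 * (τ * n * ⟪D x, (x : H)⟫_ℂ).re + _ = _
  rw [h1, mul_pow, mul_pow, sq_abs]
  ring

variable [CompleteSpace H]

theorem inner_apply_eq_of_isSelfAdjoint (hD : IsSelfAdjoint D) (x y : D.domain) :
    ⟪D x, (y : H)⟫_ℂ = ⟪(x : H), D y⟫_ℂ := by
  have h := LinearPMap.adjoint_isFormalAdjoint (T := D) hD.dense_domain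
  rw [LinearPMap.isSelfAdjoint_def.mp hD] at h
  exact h x y

theorem shiftedDirac_isFormalAdjoint (hD : IsSelfAdjoint D) (hτ : star τ = -τ) :
    (shiftedDirac D τ).IsFormalAdjoint (shiftedDirac D (-τ)) := by
  intro x y
  obtain ⟨hx, -⟩ := mem_shiftedDirac_domain.mp x.2
  obtain ⟨hy, -⟩ := mem_shiftedDirac_domain.mp y.2
  rw [lp.inner_eq_tsum, lp.inner_eq_tsum]
  refine tsum_congr fun n => ?_
  rw [shiftedDirac_apply x n (hx n), shiftedDirac_apply y n (hy n), inner_add_left,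
    inner_add_right, inner_smul_left, inner_smul_right,
    inner_apply_eq_of_isSelfAdjoint hD ⟨_, hx n⟩ ⟨_, hy n⟩, map_mul,
    show (starRingEnd ℂ) τ = -τ from hτ, map_intCast]

theorem adjoint_shiftedDirac (hD : IsSelfAdjoint D) (hτ : star τ = -τ) (hτ1 : ‖τ‖ = 1) :
    (shiftedDirac D τ).adjoint = shiftedDirac D (-τ) := by
  have hdense := dense_shiftedDirac_domain (τ := τ) hD.dense_domain
  have hle := (shiftedDirac_isFormalAdjoint hD hτ).le_adjoint hdense
  refine (LinearPMap.eq_of_le_of_domain_eq hle (le_antisymm hle.1 fun x hx => ?_)).symm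
  set z := (shiftedDirac D τ).adjoint ⟨x, hx⟩ with hz
  have hadj := LinearPMap.adjoint_isFormalAdjoint (T := shiftedDirac D τ) hdense ⟨x, hx⟩
  have hn : ∀ n, ∃ h : x n ∈ D.domain, D ⟨x n, h⟩ = z n + (τ * n) • x n := by
    intro n
    have key : ∀ v : D.domain, ⟪z n + (τ * n) • x n, (v : H)⟫_ℂ = ⟪x n, D v⟫_ℂ := by
      intro v
      have h1 := hadj ⟨lp.single 2 n v, single_mem_shiftedDirac_domain v.2 n⟩
      rw [lp.inner_single_right, lp.inner_eq_tsum, tsum_eq_single n] at h1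
      · rw [shiftedDirac_apply _ n (by rw [lp.single_apply_self]; exact v.2)] at h1
        simp only [lp.single_apply_self] at h1
        rw [inner_add_left, h1, inner_add_right, inner_smul_left, inner_smul_right, map_mul,
          map_intCast, show (starRingEnd ℂ) τ = -τ from hτ]
        ring
      · intro m hm
        have h0 := lp.single_apply_ne (E := fun _ : ℤ => H) 2 n (v : H) hm
        rw [shiftedDirac_apply _ m (by rw [h0]; exact zero_mem _),
          LinearPMap.apply_congr D h0 _ (zero_mem _)]
        have : D ⟨0, zero_mem _⟩ = 0 := D.map_zero
        rw [this, h0]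
        simp
    have hmem : x n ∈ D.adjoint.domain := LinearPMap.mem_adjoint_domain_of_exists _ ⟨_, key⟩
    have hval := LinearPMap.adjoint_apply_eq hD.dense_domain ⟨x n, hmem⟩ key
    have hDD := LinearPMap.isSelfAdjoint_def.mp hD
    have hle' : D.adjoint ≤ D := hDD.le
    exact ⟨hle'.1 hmem, by rw [← hval]; exact (hle'.2 rfl).symm⟩
  choose h hh using hn
  have hsq : ∀ n, ‖z n‖ ^ 2 = ‖D ⟨x n, h n⟩‖ ^ 2 + ‖(n : ℂ) • x n‖ ^ 2 := by
    intro n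
    have := norm_sq_add_imaginary_smul (inner_apply_eq_of_isSelfAdjoint hD) (τ := -τ)
      (by rw [star_neg, hτ]) ⟨x n, h n⟩ n
    rw [norm_neg, hτ1, hh n] at this
    rw [norm_smul, mul_pow, Complex.norm_intCast, sq_abs, hh n]
    rw [show z n + (τ * n) • x n + (-τ * n) • x n = z n by module] at this
    rw [this]
    ring
  have hs := (lp_hasSum_norm_sq z).summable
  refine mem_shiftedDirac_domain.mpr ⟨h, memℓp_two_iff.mpr ?_, memℓp_two_iff.mpr ?_⟩
  · refine hs.of_nonneg_of_le (fun n => by positivity) fun n => ?_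
    rw [hsq]; exact le_add_of_nonneg_right (by positivity)
  · refine hs.of_nonneg_of_le (fun n => by positivity) fun n => ?_
    rw [hsq]; exact le_add_of_nonneg_left (by positivity)

end Unbounded

section OffDiagonal

variable {H₀ H₁ : Type*} [NormedAddCommGroup H₀] [InnerProductSpace ℂ H₀]
  [NormedAddCommGroup H₁] [InnerProductSpace ℂ H₁]

theorem dense_offDiagonal_domain {S : H₁ →ₗ.[ℂ] H₀} {T : H₀ →ₗ.[ℂ] H₁}
    (hS : Dense (S.domain : Set H₁)) (hT : Dense (T.domain : Set H₀)) :
    Dense ((offDiagonal S T).domain : Set (WithLp 2 (H₀ × H₁))) :=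
  (hT.prod hS).preimage (WithLp.prodContinuousLinearEquiv 2 ℂ H₀ H₁).toHomeomorph.isOpenMap

theorem isSelfAdjoint_offDiagonal [CompleteSpace H₀] [CompleteSpace H₁] {S : H₁ →ₗ.[ℂ] H₀}
    {T : H₀ →ₗ.[ℂ] H₁} (hS : Dense (S.domain : Set H₁)) (hT : Dense (T.domain : Set H₀))
    (hST : S.adjoint = T) (hTS : T.adjoint = S) : IsSelfAdjoint (offDiagonal S T) := by
  have hdense := dense_offDiagonal_domain hS hT
  have hTfS : T.IsFormalAdjoint S := hST ▸ S.adjoint_isFormalAdjoint hS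
  have hformal : (offDiagonal S T).IsFormalAdjoint (offDiagonal S T) := by
    intro x y
    rw [WithLp.prod_inner_apply, WithLp.prod_inner_apply]
    exact (congrArg₂ (· + ·) (hTfS.symm ⟨x.1.snd, x.2.2⟩ ⟨y.1.fst, y.2.1⟩)
      (hTfS ⟨x.1.fst, x.2.1⟩ ⟨y.1.snd, y.2.2⟩)).trans (add_comm _ _)
  have hle := hformal.le_adjoint hdense
  rw [LinearPMap.isSelfAdjoint_def]
  refine (LinearPMap.eq_of_le_of_domain_eq hle (le_antisymm hle.1 fun x hx => ?_)).symm
  set z := (offDiagonal S T).adjoint ⟨x, hx⟩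
  have hadj := LinearPMap.adjoint_isFormalAdjoint (T := offDiagonal S T) hdense ⟨x, hx⟩
  constructor
  · rw [← hST]
    refine LinearPMap.mem_adjoint_domain_of_exists _ ⟨z.snd, fun y => ?_⟩
    have h := hadj ⟨WithLp.toLp 2 (0, (y : H₁)), ⟨zero_mem _, y.2⟩⟩
    rw [WithLp.prod_inner_apply, WithLp.prod_inner_apply] at h
    have h0 : offDiagonal S T ⟨WithLp.toLp 2 (0, (y : H₁)), ⟨zero_mem _, y.2⟩⟩ =
        WithLp.toLp 2 (S y, 0) := by
      change WithLp.toLp 2 (S y, T 0) = _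
      rw [T.map_zero]
    rw [h0] at h
    simpa using h
  · rw [← hTS]
    refine LinearPMap.mem_adjoint_domain_of_exists _ ⟨z.fst, fun y => ?_⟩
    have h := hadj ⟨WithLp.toLp 2 ((y : H₀), 0), ⟨y.2, zero_mem _⟩⟩
    rw [WithLp.prod_inner_apply, WithLp.prod_inner_apply] at h
    have h0 : offDiagonal S T ⟨WithLp.toLp 2 ((y : H₀), 0), ⟨y.2, zero_mem _⟩⟩ =
        WithLp.toLp 2 (0, T y) := by
      change WithLp.toLp 2 (S 0, T y) = _
      rw [S.map_zero]
    rw [h0] at h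
    simpa using h

end OffDiagonal

section CompactResolvent

variable {H : Type*} [NormedAddCommGroup H] [InnerProductSpace ℂ H] [CompleteSpace H]

theorem HasCompactResolvent.of_orthonormal {ι : Type*} {D : H →ₗ.[ℂ] H} {v : ι → H} {μ : ι → ℝ}
    (hv : Orthonormal ℂ v) (htot : ∀ x, (∀ i, ⟪v i, x⟫_ℂ = 0) → x = 0)
    (heig : ∀ i, ∃ h : v i ∈ D.domain, D ⟨v i, h⟩ = (μ i : ℂ) • v i)
    (hμ : Tendsto (fun i => |μ i|) cofinite atTop) : HasCompactResolvent D := by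
  let e := Equiv.ofInjective v hv.linearIndependent.injective
  have hw : (Submodule.span ℂ (Set.range (Subtype.val : Set.range v → H)))ᗮ = ⊥ := by
    rw [Submodule.eq_bot_iff]
    refine fun x hx => htot x fun i => (Submodule.mem_orthogonal _ _).mp hx _ ?_
    exact Submodule.subset_span ⟨⟨v i, i, rfl⟩, rfl⟩
  refine ⟨Set.range v, HilbertBasis.mkOfOrthogonalEqBot hv.toSubtypeRange hw,
    fun j => μ (e.symm j), fun j => ?_, hμ.comp e.symm.injective.tendsto_cofinite⟩
  rw [HilbertBasis.coe_mkOfOrthogonalEqBot]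
  obtain ⟨i, rfl⟩ := e.surjective j
  beta_reduce
  rw [e.symm_apply_apply]
  exact heig i

theorem tendsto_abs_sqrt_sq_add_sq {ι : Type*} {μ : ι → ℝ}
    (hμ : Tendsto (fun i => |μ i|) cofinite atTop) (c : Bool → ℝ) (hc : ∀ s, |c s| = 1) :
    Tendsto (fun p : ι × ℤ × Bool => |c p.2.2 * √(μ p.1 ^ 2 + (p.2.1 : ℝ) ^ 2)|)
      cofinite atTop := by
  refine tendsto_atTop.mpr fun R => ?_
  have h1 : {i | ¬ R ≤ |μ i|}.Finite := (tendsto_atTop.mp hμ R)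
  have h2 : {n : ℤ | ¬ R ≤ |(n : ℝ)|}.Finite := by
    refine (Set.finite_Icc (-⌈R⌉) ⌈R⌉).subset fun n hn => ?_
    have hn' : |(n : ℝ)| < R := not_le.mp hn
    have hlt := abs_lt.mp (hn'.trans_le (Int.le_ceil R))
    constructor
    · exact_mod_cast hlt.1.le
    · exact_mod_cast hlt.2.le
  refine (h1.prod (h2.prod Set.finite_univ)).subset fun p hp => ?_
  have hp' : |c p.2.2 * √(μ p.1 ^ 2 + (p.2.1 : ℝ) ^ 2)| < R := not_le.mp hp
  rw [abs_mul, hc, one_mul, abs_of_nonneg (Real.sqrt_nonneg _)] at hp'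
  refine ⟨not_le.mpr (lt_of_le_of_lt ?_ hp'), not_le.mpr (lt_of_le_of_lt ?_ hp'), trivial⟩
  · exact Real.abs_le_sqrt (le_add_of_nonneg_right (sq_nonneg _))
  · exact Real.abs_le_sqrt (le_add_of_nonneg_left (sq_nonneg _))

omit [CompleteSpace H] in
theorem shiftedDirac_apply_single {D : H →ₗ.[ℂ] H} (τ : ℂ) (v : D.domain) (j : ℤ) :
    shiftedDirac D τ ⟨lp.single 2 j v, single_mem_shiftedDirac_domain v.2 j⟩ =
      lp.single 2 j (D v + (τ * j) • (v : H)) := by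
  ext m
  rcases eq_or_ne m j with rfl | hmn
  · rw [shiftedDirac_apply _ m (by rw [lp.single_apply_self]; exact v.2),
      LinearPMap.apply_congr D (lp.single_apply_self _ _ _) _ v.2]
    simp only [lp.single_apply_self]
  · have h0 := lp.single_apply_ne (E := fun _ : ℤ => H) 2 j (v : H) hmn
    rw [shiftedDirac_apply _ m (by rw [h0]; exact zero_mem _),
      LinearPMap.apply_congr D h0 _ (zero_mem _), h0]
    have : D ⟨0, zero_mem _⟩ = 0 := D.map_zero
    rw [this, lp.single_apply_ne _ _ _ hmn]
    simp

omit [CompleteSpace H] in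
theorem shiftedDirac_smul_single {D : H →ₗ.[ℂ] H} (τ : ℂ) {v : H} (hv : v ∈ D.domain) {r : ℂ}
    (h : D ⟨v, hv⟩ = r • v) (n : ℤ) (c : ℂ)
    (hm : c • lp.single 2 n v ∈ (shiftedDirac D τ).domain) :
    shiftedDirac D τ ⟨c • lp.single 2 n v, hm⟩ = (c * (r + τ * n)) • lp.single 2 n v := by
  have h1 := shiftedDirac_apply_single τ ⟨v, hv⟩ n
  rw [h, ← add_smul, lp.single_smul] at h1
  rw [mul_smul, ← h1]
  exact (shiftedDirac D τ).map_smul c ⟨lp.single 2 n v, single_mem_shiftedDirac_domain hv n⟩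

/-- The sign attached to a Boolean. -/
def boolSign (s : Bool) : ℝ := if s then 1 else -1

theorem boolSign_mul_self (s : Bool) : boolSign s * boolSign s = 1 := by
  cases s <;> simp [boolSign]

theorem abs_boolSign (s : Bool) : |boolSign s| = 1 := by cases s <;> simp [boolSign]

omit [CompleteSpace H] in
theorem orthonormal_single {ι : Type*} {v : ι → H} (hv : Orthonormal ℂ v) :
    Orthonormal ℂ fun p : ι × ℤ => (lp.single 2 p.2 (v p.1) : ℓ²(ℤ, H)) := by
  classical
  rw [orthonormal_iff_ite] at hv ⊢
  rintro ⟨i, m⟩ ⟨j, n⟩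
  rw [lp.inner_single_left]
  rcases eq_or_ne m n with rfl | h
  · rw [lp.single_apply_self, hv]
    simp
  · rw [lp.single_apply_ne _ _ _ h, inner_zero_right, if_neg (by simp [h])]

omit [CompleteSpace H] in
theorem eq_zero_of_inner_single_eq_zero {ι : Type*} (b : HilbertBasis ι ℂ H) {x : ℓ²(ℤ, H)}
    (hx : ∀ i n, ⟪(lp.single 2 n (b i) : ℓ²(ℤ, H)), x⟫_ℂ = 0) : x = 0 := by
  ext n
  refine b.repr.map_eq_zero_iff.mp (lp.ext (funext fun i => ?_))
  have := hx i n
  rw [lp.inner_single_left] at this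
  rw [b.repr_apply_apply, this]
  rfl

theorem hasCompactResolvent_offDiagonal {D : H →ₗ.[ℂ] H} (hD : HasCompactResolvent D) :
    HasCompactResolvent
      (offDiagonal (shiftedDirac D (-Complex.I)) (shiftedDirac D Complex.I)) := by
  classical
  obtain ⟨w, b, μ, hb, hμ⟩ := hD
  have hphase : ∀ z : ℂ, ∃ u : ℂ, (starRingEnd ℂ) u * u = 1 ∧ z = ‖z‖ * u ∧
      u * (starRingEnd ℂ) z = ‖z‖ := fun z => by
    rcases eq_or_ne z 0 with rfl | hz
    · exact ⟨1, by simp⟩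
    · have hz' : ((‖z‖ : ℝ) : ℂ) ≠ 0 := by simpa using hz
      refine ⟨z / ‖z‖, ?_, (mul_div_cancel₀ _ hz').symm, ?_⟩
      · rw [map_div₀, Complex.conj_ofReal, div_mul_div_comm, Complex.conj_mul', ← pow_two,
          div_self (pow_ne_zero 2 hz')]
      · rw [div_mul_eq_mul_div, Complex.mul_conj', pow_two, mul_div_cancel_left₀ _ hz']
  choose U hU1 hU hUc using hphase
  let d : w × ℤ → ℂ := fun p => μ p.1 + Complex.I * p.2
  let e : w × ℤ → ℓ²(ℤ, H) := fun p => lp.single 2 p.2 (b p.1)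
  have he : Orthonormal ℂ e := orthonormal_single b.orthonormal
  let k : ℂ := ((√2)⁻¹ : ℝ)
  have hkc : (starRingEnd ℂ) k = k := Complex.conj_ofReal _
  have hk : k * k = 1 / 2 := by
    simp only [k]
    rw [← Complex.ofReal_mul, ← mul_inv, Real.mul_self_sqrt (by norm_num)]
    push_cast; norm_num
  have hk0 : k ≠ 0 := by simp [k]
  let c : w × ℤ × Bool → ℂ := fun p => k * boolSign p.2.2 * U (d (p.1, p.2.1))
  let v : w × ℤ × Bool → WithLp 2 (ℓ²(ℤ, H) × ℓ²(ℤ, H)) := fun p =>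
    WithLp.toLp 2 (k • e (p.1, p.2.1), c p • e (p.1, p.2.1))
  refine HasCompactResolvent.of_orthonormal (v := v)
    (μ := fun p => boolSign p.2.2 * √(μ p.1 ^ 2 + (p.2.1 : ℝ) ^ 2)) ?_ ?_ ?_
    (tendsto_abs_sqrt_sq_add_sq hμ boolSign abs_boolSign)
  · rw [orthonormal_iff_ite] at he ⊢
    rintro ⟨i, m, s⟩ ⟨j, n, t⟩
    rw [WithLp.prod_inner_apply]
    simp only [v, inner_smul_left, inner_smul_right]
    rw [he (i, m) (j, n)]
    by_cases h : (i, m) = (j, n)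
    · obtain ⟨rfl, rfl⟩ := Prod.mk.inj h
      simp only [if_true, mul_one, c, map_mul, hkc, Complex.conj_ofReal]
      have h1 := hU1 (d (i, m))
      have : k * k + k * boolSign t * U (d (i, m)) *
            (k * boolSign s * (starRingEnd ℂ) (U (d (i, m)))) =
          k * k * (1 + (boolSign s * boolSign t : ℝ) *
            ((starRingEnd ℂ) (U (d (i, m))) * U (d (i, m)))) := by
        push_cast; ring
      rw [this, h1, hk]
      cases s <;> cases t <;> norm_num [boolSign]
    · rw [if_neg h,
        if_neg fun h' => h (Prod.ext (Prod.mk.inj h').1 (Prod.mk.inj (Prod.mk.inj h').2).1)]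
      simp
  · intro x hx
    have h : ∀ p : w × ℤ, ⟪e p, x.ofLp.1⟫_ℂ = 0 ∧ ⟪e p, x.ofLp.2⟫_ℂ = 0 := by
      rintro ⟨i, n⟩
      have h1 := hx (i, n, true)
      have h2 := hx (i, n, false)
      rw [WithLp.prod_inner_apply] at h1 h2
      simp only [v, inner_smul_left, c, map_mul, hkc, Complex.conj_ofReal, boolSign, if_true,
        Bool.false_eq_true, if_false] at h1 h2
      push_cast at h1 h2
      have hu0 : (starRingEnd ℂ) (U (d (i, n))) ≠ 0 := left_ne_zero_of_mul_eq_one (hU1 _)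
      constructor
      · have : k * ⟪e (i, n), x.ofLp.1⟫_ℂ = 0 := by linear_combination (h1 + h2) / 2
        exact (mul_eq_zero.mp this).resolve_left hk0
      · have : (k * (starRingEnd ℂ) (U (d (i, n)))) * ⟪e (i, n), x.ofLp.2⟫_ℂ = 0 := by
          linear_combination (h1 - h2) / 2
        exact (mul_eq_zero.mp this).resolve_left (mul_ne_zero hk0 hu0)
    have h1 : x.fst = 0 := eq_zero_of_inner_single_eq_zero b fun i n => (h (i, n)).1
    have h2 : x.snd = 0 := eq_zero_of_inner_single_eq_zero b fun i n => (h (i, n)).2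
    exact (WithLp.ofLp_injective 2) (Prod.ext h1 h2)
  · rintro ⟨i, n, s⟩
    obtain ⟨hm, hi⟩ := hb i
    have m1 : c (i, n, s) • e (i, n) ∈ (shiftedDirac D (-Complex.I)).domain :=
      Submodule.smul_mem _ _ (single_mem_shiftedDirac_domain hm n)
    have m2 : k • e (i, n) ∈ (shiftedDirac D Complex.I).domain :=
      Submodule.smul_mem _ _ (single_mem_shiftedDirac_domain hm n)
    refine ⟨⟨m2, m1⟩, ?_⟩
    change WithLp.toLp 2 (shiftedDirac D (-Complex.I) ⟨c (i, n, s) • e (i, n), m1⟩,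
      shiftedDirac D Complex.I ⟨k • e (i, n), m2⟩) = _
    have hdn : √(μ i ^ 2 + (n : ℝ) ^ 2) = ‖d (i, n)‖ := by
      have : d (i, n) = (μ i : ℂ) + ((n : ℝ) : ℂ) * Complex.I := by simp [d, mul_comm]
      rw [this, Complex.norm_add_mul_I]
    have hdc : (μ i : ℂ) + -Complex.I * n = (starRingEnd ℂ) (d (i, n)) := by simp [d]
    rw [shiftedDirac_smul_single _ hm hi, shiftedDirac_smul_single _ hm hi, hdn, hdc, ← WithLp.toLp_smul,
      Prod.smul_mk, smul_smul, smul_smul]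
    have hs : ((boolSign s : ℝ) : ℂ) * boolSign s = 1 := by exact_mod_cast boolSign_mul_self s
    congr 3
    · simp only [c]
      push_cast
      linear_combination (k * boolSign s) * hUc (d (i, n))
    · simp only [c]
      push_cast
      change k * d (i, n) = _
      linear_combination k * hU (d (i, n)) - (k * ‖d (i, n)‖ * U (d (i, n))) * hs

end CompactResolvent

section Commutators

variable {H : Type*} [NormedAddCommGroup H] [InnerProductSpace ℂ H] {D : H →ₗ.[ℂ] H} {τ : ℂ}

theorem extendsCommutator_translation (k : ℤ) :
    ExtendsCommutator (shiftedDirac D τ) (translation k) ((τ * k) • translation k) := fun x => by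
  obtain ⟨h, h1, h2⟩ := mem_shiftedDirac_domain.mp x.2
  have hmem : translation k x.1 ∈ (shiftedDirac D τ).domain := by
    refine mem_shiftedDirac_domain.mpr ⟨fun n => h (n - k), (translation k ⟨_, h1⟩).2, ?_⟩
    convert (translation k ⟨_, h2⟩).2.add ((lp.memℓp (translation k x.1)).const_smul (k : ℂ)) using 2
      with n
    change (n : ℂ) • x.1 (n - k) = ((n - k : ℤ) : ℂ) • x.1 (n - k) + (k : ℂ) • x.1 (n - k)
    push_cast
    module
  refine ⟨hmem, lp.ext (funext fun n => ?_)⟩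
  change shiftedDirac D τ ⟨translation k x.1, hmem⟩ n - shiftedDirac D τ x (n - k) =
    (τ * k) • x.1 (n - k)
  rw [shiftedDirac_apply _ n (h (n - k)), shiftedDirac_apply x (n - k) (h (n - k))]
  change D ⟨x.1 (n - k), _⟩ + (τ * n) • x.1 (n - k) - _ = _
  push_cast
  module

theorem extendsCommutator_diagonalOp {R S : ℤ → H →L[ℂ] H} {C C' : ℝ} (hR : ∀ n, ‖R n‖ ≤ C)
    (hS : ∀ n, ‖S n‖ ≤ C') (h : ∀ n, ExtendsCommutator D (R n) (S n)) :
    ExtendsCommutator (shiftedDirac D τ) (diagonalOp R C hR) (diagonalOp S C' hS) := fun x => by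
  obtain ⟨hx, h1, h2⟩ := mem_shiftedDirac_domain.mp x.2
  have hm : ∀ n, R n (x.1 n) ∈ D.domain := fun n => (h n ⟨x.1 n, hx n⟩).1
  have he : ∀ n, D ⟨R n (x.1 n), hm n⟩ = R n (D ⟨x.1 n, hx n⟩) + S n (x.1 n) := fun n => by
    rw [← (h n ⟨x.1 n, hx n⟩).2]
    abel
  have hmem : diagonalOp R C hR x.1 ∈ (shiftedDirac D τ).domain := by
    refine mem_shiftedDirac_domain.mpr ⟨hm, ?_, ?_⟩
    · change Memℓp (fun n => D ⟨R n (x.1 n), hm n⟩) 2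
      rw [funext he]
      exact (diagonalOp R C hR ⟨_, h1⟩).2.add (diagonalOp S C' hS x.1).2
    · change Memℓp (fun n : ℤ => (n : ℂ) • R n (x.1 n)) 2
      simp_rw [← map_smul]
      exact (diagonalOp R C hR ⟨_, h2⟩).2
  refine ⟨hmem, lp.ext (funext fun n => ?_)⟩
  change shiftedDirac D τ ⟨diagonalOp R C hR x.1, hmem⟩ n - R n (shiftedDirac D τ x n) =
    S n (x.1 n)
  rw [shiftedDirac_apply _ n (hm n), shiftedDirac_apply x n (hx n), map_add, map_smul]
  change D ⟨R n (x.1 n), hm n⟩ + (τ * n) • R n (x.1 n) - _ = _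
  rw [he]
  abel

end Commutators

section Doubling

variable {E : Type*} [NormedAddCommGroup E] [InnerProductSpace ℂ E]

/-- The operator matrix `[[0, S], [T, 0]]` with bounded entries. -/
noncomputable def offDiagonalCLM (S T : E →L[ℂ] E) : WithLp 2 (E × E) →L[ℂ] WithLp 2 (E × E) :=
  ((WithLp.prodContinuousLinearEquiv 2 ℂ E E).symm : E × E →L[ℂ] WithLp 2 (E × E)) ∘L
    ((S ∘L ContinuousLinearMap.snd ℂ E E).prod (T ∘L ContinuousLinearMap.fst ℂ E E)) ∘L
    (WithLp.prodContinuousLinearEquiv 2 ℂ E E : WithLp 2 (E × E) →L[ℂ] E × E)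

/-- The operator matrix `[[T, 0], [0, T]]`. -/
noncomputable def doubleCLM (T : E →L[ℂ] E) : WithLp 2 (E × E) →L[ℂ] WithLp 2 (E × E) :=
  ((WithLp.prodContinuousLinearEquiv 2 ℂ E E).symm : E × E →L[ℂ] WithLp 2 (E × E)) ∘L
    (T.prodMap T) ∘L
    (WithLp.prodContinuousLinearEquiv 2 ℂ E E : WithLp 2 (E × E) →L[ℂ] E × E)

theorem offDiagonalCLM_apply (S T : E →L[ℂ] E) (x : WithLp 2 (E × E)) :
    offDiagonalCLM S T x = WithLp.toLp 2 (S x.snd, T x.fst) := rfl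

theorem ExtendsCommutator.offDiagonal {D₀ D₁ : E →ₗ.[ℂ] E} {T S₀ S₁ : E →L[ℂ] E}
    (h₀ : ExtendsCommutator D₀ T S₀) (h₁ : ExtendsCommutator D₁ T S₁) :
    ExtendsCommutator (offDiagonal D₀ D₁) (doubleCLM T) (offDiagonalCLM S₀ S₁) := fun x => by
  obtain ⟨m₁, e₁⟩ := h₁ ⟨x.1.fst, x.2.1⟩
  obtain ⟨m₀, e₀⟩ := h₀ ⟨x.1.snd, x.2.2⟩
  refine ⟨⟨m₁, m₀⟩, ?_⟩
  rw [offDiagonalCLM_apply, ← e₁, ← e₀]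
  rfl

theorem ExtendsCommutator.norm_lower_le {D₀ D₁ : E →ₗ.[ℂ] E} {T : E →L[ℂ] E}
    {C : WithLp 2 (E × E) →L[ℂ] WithLp 2 (E × E)}
    (hC : ExtendsCommutator (QuantumMetric.offDiagonal D₀ D₁) (doubleCLM T) C) (u : D₁.domain) :
    ∃ m : T u ∈ D₁.domain, ‖D₁ ⟨T u, m⟩ - T (D₁ u)‖ ≤ ‖C‖ * ‖(u : E)‖ := by
  obtain ⟨m, e⟩ := hC ⟨WithLp.toLp 2 ((u : E), 0), ⟨u.2, zero_mem _⟩⟩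
  refine ⟨m.1, ?_⟩
  have h : D₁ ⟨T u, m.1⟩ - T (D₁ u) = (C (WithLp.toLp 2 ((u : E), 0))).snd :=
    congrArg WithLp.snd e
  rw [h, ← WithLp.norm_toLp_fst 2 E E (u : E)]
  exact (WithLp.norm_snd_le _ _).trans (C.le_opNorm _)

theorem ExtendsCommutator.norm_upper_le {D₀ D₁ : E →ₗ.[ℂ] E} {T : E →L[ℂ] E}
    {C : WithLp 2 (E × E) →L[ℂ] WithLp 2 (E × E)}
    (hC : ExtendsCommutator (QuantumMetric.offDiagonal D₀ D₁) (doubleCLM T) C) (u : D₀.domain) :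
    ∃ m : T u ∈ D₀.domain, ‖D₀ ⟨T u, m⟩ - T (D₀ u)‖ ≤ ‖C‖ * ‖(u : E)‖ := by
  obtain ⟨m, e⟩ := hC ⟨WithLp.toLp 2 (0, (u : E)), ⟨zero_mem _, u.2⟩⟩
  refine ⟨m.2, ?_⟩
  have h : D₀ ⟨T u, m.2⟩ - T (D₀ u) = (C (WithLp.toLp 2 (0, (u : E)))).fst :=
    congrArg WithLp.fst e
  rw [h, ← WithLp.norm_toLp_snd 2 E E (u : E)]
  exact (WithLp.norm_fst_le _ _).trans (C.le_opNorm _)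

variable [CompleteSpace E]

variable (E) in
/-- The representation `T ↦ T ⊕ T`. -/
noncomputable def doubleHom : (E →L[ℂ] E) →⋆ₐ[ℂ] (WithLp 2 (E × E) →L[ℂ] WithLp 2 (E × E)) where
  toFun := doubleCLM
  map_one' := rfl
  map_mul' _ _ := rfl
  map_zero' := rfl
  map_add' _ _ := rfl
  commutes' _ := rfl
  map_star' T := by
    rw [ContinuousLinearMap.star_eq_adjoint, ContinuousLinearMap.star_eq_adjoint,
      ContinuousLinearMap.eq_adjoint_iff]
    intro x y
    rw [WithLp.prod_inner_apply, WithLp.prod_inner_apply]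
    exact congrArg₂ (· + ·) (T.adjoint_inner_left _ _) (T.adjoint_inner_left _ _)

end Doubling

section Entries

variable {A H : Type*} [CStarAlgebra A] [NormedAddCommGroup H] [InnerProductSpace ℂ H]
  [CompleteSpace H] {π : A →⋆ₐ[ℂ] (H →L[ℂ] H)} {α : Multiplicative ℤ →* (A ≃⋆ₐ[ℂ] A)}

variable (π α) in
/-- The finite sum `∑ₙ π̃(fₙ) λₙ`. -/
noncomputable def finiteSum (f : ℤ →₀ A) : ℓ²(ℤ, H) →L[ℂ] ℓ²(ℤ, H) :=
  f.sum fun n a => covariantRep π α a * translation n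

theorem monomial_apply (a : A) (n k : ℤ) (x : ℓ²(ℤ, H)) :
    (covariantRep π α a * translation n : ℓ²(ℤ, H) →L[ℂ] ℓ²(ℤ, H)) x k =
      π (α (Multiplicative.ofAdd (-k)) a) (x (k - n)) := rfl

theorem finsuppSum_apply_single (f : ℤ →₀ A) (j n : ℤ) (v : H) :
    (finiteSum π α f) (lp.single 2 j v) (j + n) =
      π (α (Multiplicative.ofAdd (-(j + n))) (f n)) v := by
  rw [finiteSum, Finsupp.sum, _root_.sum_apply, lp.coeFn_sum, Finset.sum_apply,
    Finset.sum_eq_single n]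
  · rw [monomial_apply, add_sub_cancel_right, lp.single_apply_self]
  · intro m _ hm
    rw [monomial_apply, lp.single_apply_ne _ _ _ (by omega), map_zero]
  · intro hn
    rw [monomial_apply, Finsupp.notMem_support_iff.mp hn]
    simp

/-- The entries of a commutator with `D ⊗ 1 + τ ⊗ M_ι`. -/
theorem commutator_shiftedDirac_single {D : H →ₗ.[ℂ] H} {τ : ℂ} (f : ℤ →₀ A) (v : D.domain)
    (j n : ℤ) {y : ℓ²(ℤ, H)}
    (hy : y = (finiteSum π α f) (lp.single 2 j (v : H)))
    (hm : y ∈ (shiftedDirac D τ).domain) :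
    ∃ h : π (α (Multiplicative.ofAdd (-(j + n))) (f n)) v ∈ D.domain,
      (shiftedDirac D τ ⟨y, hm⟩ -
        (finiteSum π α f)
          (shiftedDirac D τ ⟨lp.single 2 j v, single_mem_shiftedDirac_domain v.2 j⟩)) (j + n) =
      (D ⟨_, h⟩ - π (α (Multiplicative.ofAdd (-(j + n))) (f n)) (D v)) +
        (τ * n) • π (α (Multiplicative.ofAdd (-(j + n))) (f n)) v := by
  have e : y (j + n) = π (α (Multiplicative.ofAdd (-(j + n))) (f n)) v := by
    rw [hy, finsuppSum_apply_single]
  have h' : y (j + n) ∈ D.domain := (mem_shiftedDirac_domain.mp hm).1 _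
  refine ⟨e ▸ h', ?_⟩
  rw [shiftedDirac_apply_single, lp.coeFn_sub, Pi.sub_apply, finsuppSum_apply_single,
    shiftedDirac_apply _ _ h', LinearPMap.apply_congr D e _ (e ▸ h')]
  simp only [e, map_add, map_smul]
  push_cast
  module

omit [CompleteSpace H] in
theorem norm_sq_add_norm_sq_sub_imaginary (a b : H) (n : ℤ) :
    (‖a + (Complex.I * n) • b‖ ^ 2 + ‖a + (-Complex.I * n) • b‖ ^ 2) / 2 =
      ‖a‖ ^ 2 + (n : ℝ) ^ 2 * ‖b‖ ^ 2 := by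
  have hpl := parallelogram_law_with_norm ℂ a ((Complex.I * n) • b)
  rw [norm_smul, norm_mul, Complex.norm_I, one_mul, Complex.norm_intCast] at hpl
  rw [show a + (-Complex.I * n) • b = a - (Complex.I * n) • b by module, ← sq_abs (n : ℝ)]
  linarith

theorem hasSum_norm_sq_apply_add {H : Type*} [NormedAddCommGroup H] (j : ℤ) (r : ℓ²(ℤ, H)) :
    HasSum (fun n => ‖r (j + n)‖ ^ 2) (‖r‖ ^ 2) :=
  (Equiv.addLeft j).hasSum_iff (f := fun n => ‖r n‖ ^ 2) |>.mpr (lp_hasSum_norm_sq r)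

theorem sum_norm_sq_apply_add_le {H : Type*} [NormedAddCommGroup H] (s : Finset ℤ) (j : ℤ)
    (r : ℓ²(ℤ, H)) :
    ∑ n ∈ s, ‖r (j + n)‖ ^ 2 ≤ ‖r‖ ^ 2 :=
  sum_le_hasSum s (fun n _ => sq_nonneg ‖r (j + n)‖) (hasSum_norm_sq_apply_add j r)

theorem sum_sq_entries_le {D : H →ₗ.[ℂ] H} (f : ℤ →₀ A)
    {C : WithLp 2 (ℓ²(ℤ, H) × ℓ²(ℤ, H)) →L[ℂ] WithLp 2 (ℓ²(ℤ, H) × ℓ²(ℤ, H))} (hC1 : ‖C‖ ≤ 1)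
    (hC : ExtendsCommutator (offDiagonal (shiftedDirac D (-Complex.I)) (shiftedDirac D Complex.I))
      (doubleCLM (finiteSum π α f)) C)
    (v : D.domain) (j : ℤ) :
    ∃ h : ∀ n, π (α (Multiplicative.ofAdd (-(j + n))) (f n)) v ∈ D.domain, ∀ s : Finset ℤ,
      ∑ n ∈ s, (‖D ⟨_, h n⟩ - π (α (Multiplicative.ofAdd (-(j + n))) (f n)) (D v)‖ ^ 2 +
        (n : ℝ) ^ 2 * ‖π (α (Multiplicative.ofAdd (-(j + n))) (f n)) v‖ ^ 2) ≤ ‖(v : H)‖ ^ 2 := by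
  have hle : ‖C‖ * ‖(lp.single 2 j (v : H) : ℓ²(ℤ, H))‖ ≤ ‖(v : H)‖ := by
    rw [lp.norm_single (by norm_num)]
    exact mul_le_of_le_one_left (norm_nonneg _) hC1
  obtain ⟨m1, hpn⟩ := hC.norm_lower_le ⟨_, single_mem_shiftedDirac_domain v.2 j⟩
  obtain ⟨m2, hqn⟩ := hC.norm_upper_le ⟨_, single_mem_shiftedDirac_domain v.2 j⟩
  have hP := fun n => commutator_shiftedDirac_single (τ := Complex.I) f v j n rfl m1
  have hQ := fun n => commutator_shiftedDirac_single (τ := -Complex.I) f v j n rfl m2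
  refine ⟨fun n => (hP n).1, fun s => ?_⟩
  have h1 := (sum_norm_sq_apply_add_le s j _).trans
    (pow_le_pow_left₀ (norm_nonneg _) (hpn.trans hle) 2)
  have h2 := (sum_norm_sq_apply_add_le s j _).trans
    (pow_le_pow_left₀ (norm_nonneg _) (hqn.trans hle) 2)
  rw [Finset.sum_congr rfl fun n _ => congrArg (‖·‖ ^ 2) (hP n).2] at h1
  rw [Finset.sum_congr rfl fun n _ => congrArg (‖·‖ ^ 2) (hQ n).2] at h2
  rw [Finset.sum_congr rfl fun n _ => (norm_sq_add_norm_sq_sub_imaginary _ _ n).symm,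
    ← Finset.sum_div, Finset.sum_add_distrib]
  linarith

end Entries

section Tail

variable {A H : Type*} [CStarAlgebra A] [NormedAddCommGroup H] [InnerProductSpace ℂ H]
  [CompleteSpace H] {π : A →⋆ₐ[ℂ] (H →L[ℂ] H)} {α : Multiplicative ℤ →* (A ≃⋆ₐ[ℂ] A)}

/-- The monomial map `a ↦ π̃(a) λₙ` as a bounded linear map. -/
noncomputable def monomialCLM (π : A →⋆ₐ[ℂ] (H →L[ℂ] H)) (α : Multiplicative ℤ →* (A ≃⋆ₐ[ℂ] A))
    (n : ℤ) : A →L[ℂ] (ℓ²(ℤ, H) →L[ℂ] ℓ²(ℤ, H)) where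
  toFun a := covariantRep π α a * translation n
  map_add' a b := by
    rw [← covariantHom_apply, map_add, add_mul]; rfl
  map_smul' c a := by
    rw [← covariantHom_apply, map_smul, smul_mul_assoc]; rfl
  cont := continuous_covariantRep.mul continuous_const

theorem monomialCLM_apply (a : A) (n k : ℤ) (x : ℓ²(ℤ, H)) :
    monomialCLM π α n a x k = π (α (Multiplicative.ofAdd (-k)) a) (x (k - n)) := rfl

theorem sum_sq_norm_monomial_apply_le {f : ℤ → A} {s : Finset ℤ}
    (hf : ∀ (j : ℤ) (v : H), ∑ n ∈ s,
      (n : ℝ) ^ 2 * ‖π (α (Multiplicative.ofAdd (-(j + n))) (f n)) v‖ ^ 2 ≤ ‖v‖ ^ 2)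
    (x : ℓ²(ℤ, H)) :
    ∑ n ∈ s, (n : ℝ) ^ 2 * ‖monomialCLM π α n (f n) x‖ ^ 2 ≤ ‖x‖ ^ 2 := by
  have h := hasSum_sum (s := s) fun n _ => (hasSum_norm_sq_apply_add n
    (monomialCLM π α n (f n) x)).mul_left ((n : ℝ) ^ 2)
  refine hasSum_le (fun j => ?_) h (lp_hasSum_norm_sq x)
  refine le_of_eq_of_le (Finset.sum_congr rfl fun n _ => ?_) (hf j (x j))
  rw [monomialCLM_apply, add_sub_cancel_left, add_comm n j]

theorem norm_sum_monomial_le {f : ℤ → A} {s : Finset ℤ} (h0 : (0 : ℤ) ∉ s)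
    (hf : ∀ (j : ℤ) (v : H), ∑ n ∈ s,
      (n : ℝ) ^ 2 * ‖π (α (Multiplicative.ofAdd (-(j + n))) (f n)) v‖ ^ 2 ≤ ‖v‖ ^ 2)
    {r : ℝ} (hr : 0 ≤ r) (hs : ∑ n ∈ s, 1 / (n : ℝ) ^ 2 ≤ r ^ 2) :
    ‖∑ n ∈ s, monomialCLM π α n (f n)‖ ≤ r := by
  refine ContinuousLinearMap.opNorm_le_bound _ hr fun x => ?_
  rw [_root_.sum_apply]
  refine (norm_sum_le _ _).trans (abs_le_of_sq_le_sq' ?_ (by positivity)).2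
  have h1 : ∑ n ∈ s, ‖monomialCLM π α n (f n) x‖ =
      ∑ n ∈ s, (1 / (n : ℝ)) * ((n : ℝ) * ‖monomialCLM π α n (f n) x‖) := by
    refine Finset.sum_congr rfl fun n hn => ?_
    have : (n : ℝ) ≠ 0 := by
      rintro h
      exact h0 (by rwa [Int.cast_eq_zero.mp h] at hn)
    field_simp
  rw [h1]
  refine (Finset.sum_mul_sq_le_sq_mul_sq _ _ _).trans ?_
  simp only [mul_pow, div_pow, one_pow]
  exact mul_le_mul hs (sum_sq_norm_monomial_apply_le hf x)
    (Finset.sum_nonneg fun _ _ => by positivity) (sq_nonneg r)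

theorem totallyBounded_add {V : Type*} [NormedAddCommGroup V] [CompleteSpace V] {s t : Set V}
    (hs : TotallyBounded s) (ht : TotallyBounded t) :
    TotallyBounded {x | ∃ a ∈ s, ∃ b ∈ t, x = a + b} := by
  have h := (hs.closure.isCompact_of_isClosed isClosed_closure).add
    (ht.closure.isCompact_of_isClosed isClosed_closure)
  refine h.totallyBounded.subset ?_
  rintro _ ⟨a, ha, b, hb, rfl⟩
  exact Set.add_mem_add (subset_closure ha) (subset_closure hb)

theorem totallyBounded_finset_sum {ι V W : Type*} [SeminormedAddCommGroup W] [NormedSpace ℂ W]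
    [NormedAddCommGroup V] [NormedSpace ℂ V] [CompleteSpace V] {B : Set W}
    (hB : TotallyBounded B) (Φ : ι → W →L[ℂ] V) (s : Finset ι) :
    TotallyBounded {x : V | ∃ g : ι → W, (∀ i ∈ s, g i ∈ B) ∧ x = ∑ i ∈ s, Φ i (g i)} := by
  classical
  induction s using Finset.induction_on with
  | empty =>
    refine (Set.finite_singleton (0 : V)).totallyBounded.subset ?_
    rintro x ⟨g, -, rfl⟩
    simp
  | insert i s hi ih =>
    refine (totallyBounded_add (hB.image (Φ i).uniformContinuous) ih).subset ?_
    rintro x ⟨g, hg, rfl⟩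
    refine ⟨_, ⟨g i, hg i (Finset.mem_insert_self i s), rfl⟩, _,
      ⟨g, fun j hj => hg j (Finset.mem_insert_of_mem hj), rfl⟩, Finset.sum_insert hi⟩

end Tail

section Main

variable {A H : Type*} [CStarAlgebra A] [NormedAddCommGroup H] [InnerProductSpace ℂ H]
  [CompleteSpace H] (T : OddSpectralTriple A H) {α : Multiplicative ℤ →* (A ≃⋆ₐ[ℂ] A)}

namespace OddSpectralTriple

theorem extendsCommutator (a : T.alg) : ExtendsCommutator T.D (T.rep a) (T.commutator a) :=
  Classical.choose_spec (T.bounded_commutator a a.2)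

theorem lipSeminorm_smul (c : ℂ) (a : T.alg) : T.lipSeminorm (c • a) = ‖c‖ * T.lipSeminorm a := by
  have h : ExtendsCommutator T.D (T.rep (c • a : T.alg)) (c • T.commutator a) := fun x => by
    obtain ⟨m, e⟩ := T.extendsCommutator a x
    have e1 : T.rep (c • a : T.alg) = c • T.rep a := map_smul T.rep c (a : A)
    rw [e1]
    refine ⟨T.D.domain.smul_mem c m, ?_⟩
    change T.D (c • ⟨T.rep a x, m⟩) - c • T.rep a (T.D x) = c • T.commutator a x
    rw [T.D.map_smul, ← e, smul_sub]
  rw [lipSeminorm, (T.extendsCommutator (c • a)).unique T.dense_domain h, norm_smul, lipSeminorm]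

theorem lipSeminorm_le_of_forall (a : T.alg) {r : ℝ} (hr : 0 ≤ r)
    (h : ∀ v : T.D.domain, ∃ m : T.rep a v ∈ T.D.domain,
      ‖T.D ⟨T.rep a v, m⟩ - T.rep a (T.D v)‖ ≤ r * ‖(v : H)‖) : T.lipSeminorm a ≤ r := by
  refine ContinuousLinearMap.opNorm_le_bound _ hr fun x => ?_
  refine T.dense_domain.induction (P := fun x => ‖T.commutator a x‖ ≤ r * ‖x‖) ?_ ?_ x
  · intro v hv
    obtain ⟨m, hm⟩ := h ⟨v, hv⟩
    obtain ⟨_, e⟩ := T.extendsCommutator a ⟨v, hv⟩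
    rwa [← e]
  · exact isClosed_le (by fun_prop) (by fun_prop)

theorem totallyBounded_lipBall [Nontrivial H] (hfaithful : Function.Injective T.rep)
    (hLip : T.LipschitzCondition) (R : ℝ) :
    TotallyBounded {a : A | ∃ h : a ∈ T.alg, T.lipSeminorm ⟨a, h⟩ ≤ 1 ∧ ‖a‖ ≤ R} := by
  obtain ⟨v, hv⟩ := exists_norm_eq H zero_le_one
  obtain ⟨φ, -⟩ := exists_vectorState T.rep hv
  have h1 := InducesLipMetric.totallyBounded hLip T.rep hfaithful φ
  have h2 : TotallyBounded ((fun c : ℂ => c • (1 : A)) '' Metric.closedBall 0 R) :=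
    ((isCompact_closedBall _ _).image (by fun_prop)).totallyBounded
  refine (totallyBounded_add h1 h2).subset ?_
  rintro a ⟨ha, hL, hn⟩
  refine ⟨_, ⟨⟨a, ha⟩, hL, rfl⟩, _, ⟨φ.1 a, ?_, rfl⟩, (sub_add_cancel _ _).symm⟩
  rw [mem_closedBall_zero_iff]
  exact (norm_state_apply_le φ a).trans hn

theorem exists_extendsCommutator_of_mem_finiteSums
    (smooth : ∀ g, ∀ a ∈ T.alg, α g a ∈ T.alg)
    (hbdd : ∀ a : T.alg, BddAbove (Set.range fun g => T.lipSeminorm ⟨α g a, smooth g a a.2⟩))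
    (τ : ℂ) {x : ℓ²(ℤ, H) →L[ℂ] ℓ²(ℤ, H)} (hx : x ∈ finiteSums T.rep α T.alg) :
    ∃ S, ExtendsCommutator (shiftedDirac T.D τ) x S := by
  refine finiteSums_induction (P := fun x => ∃ S, ExtendsCommutator (shiftedDirac T.D τ) x S)
    ⟨0, .zero _⟩ (fun x y ⟨S, hS⟩ ⟨S', hS'⟩ => ⟨_, hS.add hS'⟩) (fun a ha n => ?_) hx
  obtain ⟨C, hC⟩ := hbdd ⟨a, ha⟩
  have hS := extendsCommutator_diagonalOp (D := T.D) (τ := τ)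
    (R := fun n => T.rep (α (Multiplicative.ofAdd (-n)) a)) (C := ‖a‖)
    (S := fun n => T.commutator ⟨α (Multiplicative.ofAdd (-n)) a, smooth _ a ha⟩) (C' := C)
    (fun n => (NonUnitalStarAlgHom.norm_apply_le T.rep _).trans
      (NonUnitalStarAlgHom.norm_apply_le (α (Multiplicative.ofAdd (-n))) a))
    (fun n => hC ⟨_, rfl⟩) (fun n => T.extendsCommutator ⟨_, smooth _ a ha⟩)
  exact ⟨_, ExtendsCommutator.mul (T := covariantRep T.rep α a) hS (extendsCommutator_translation n)⟩

/-- The even spectral triple on the crossed product. -/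
noncomputable def crossedTriple (smooth : ∀ g, ∀ a ∈ T.alg, α g a ∈ T.alg)
    (hbdd : ∀ a : T.alg, BddAbove (Set.range fun g => T.lipSeminorm ⟨α g a, smooth g a a.2⟩)) :
    EvenSpectralTriple (crossedProduct T.rep α) ℓ²(ℤ, H) ℓ²(ℤ, H) where
  separable_algebra :=
    have := T.separable_algebra
    separableSpace_crossedProduct
  alg := (finiteSumsSubalgebra T.rep smooth).comap (crossedProduct T.rep α).subtype
  dense_alg := dense_finiteSums smooth T.dense_alg
  rep := (doubleHom ℓ²(ℤ, H)).comp (crossedProduct T.rep α).subtype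
  D := offDiagonal (shiftedDirac T.D (-Complex.I)) (shiftedDirac T.D Complex.I)
  dense_domain := dense_offDiagonal_domain (dense_shiftedDirac_domain T.dense_domain)
    (dense_shiftedDirac_domain T.dense_domain)
  selfAdjoint := isSelfAdjoint_offDiagonal (dense_shiftedDirac_domain T.dense_domain)
    (dense_shiftedDirac_domain T.dense_domain)
    (by rw [adjoint_shiftedDirac T.selfAdjoint (by simp) (by simp), neg_neg])
    (adjoint_shiftedDirac T.selfAdjoint (by simp) (by simp))
  compactResolvent := hasCompactResolvent_offDiagonal T.compactResolvent
  bounded_commutator x hx := by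
    obtain ⟨S, hS⟩ := T.exists_extendsCommutator_of_mem_finiteSums smooth hbdd (-Complex.I) hx
    obtain ⟨S', hS'⟩ := T.exists_extendsCommutator_of_mem_finiteSums smooth hbdd Complex.I hx
    exact ⟨_, hS.offDiagonal hS'⟩
  rep₀ := (crossedProduct T.rep α).subtype
  rep₁ := (crossedProduct T.rep α).subtype
  rep_eq _ _ := rfl
  D₀ := shiftedDirac T.D (-Complex.I)
  dense_domain₀ := dense_shiftedDirac_domain T.dense_domain
  D_eq := by rw [adjoint_shiftedDirac T.selfAdjoint (by simp) (by simp), neg_neg]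

omit [CompleteSpace H] in
theorem crossedDirac_eq (D : H →ₗ.[ℂ] H) : crossedDirac D id =
    offDiagonal (shiftedDirac D (-Complex.I)) (shiftedDirac D Complex.I) := by
  rw [crossedDirac, tensorOne_sub_smul]
  rfl

end OddSpectralTriple
end Main

section Main

variable {A H : Type*} [CStarAlgebra A] [NormedAddCommGroup H] [InnerProductSpace ℂ H]
  [CompleteSpace H] (T : OddSpectralTriple A H) {α : Multiplicative ℤ →* (A ≃⋆ₐ[ℂ] A)}

namespace OddSpectralTriple

section Coefficients

variable {f : ℤ →₀ A}
  {C : WithLp 2 (ℓ²(ℤ, H) × ℓ²(ℤ, H)) →L[ℂ] WithLp 2 (ℓ²(ℤ, H) × ℓ²(ℤ, H))}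

theorem sum_sq_coeff_le (hC1 : ‖C‖ ≤ 1)
    (hC : ExtendsCommutator
      (offDiagonal (shiftedDirac T.D (-Complex.I)) (shiftedDirac T.D Complex.I))
      (doubleCLM (finiteSum T.rep α f)) C) (s : Finset ℤ) (j : ℤ) (v : H) :
    ∑ n ∈ s, (n : ℝ) ^ 2 * ‖T.rep (α (Multiplicative.ofAdd (-(j + n))) (f n)) v‖ ^ 2 ≤
      ‖v‖ ^ 2 := by
  refine T.dense_domain.induction (P := fun v => ∑ n ∈ s, (n : ℝ) ^ 2 *
    ‖T.rep (α (Multiplicative.ofAdd (-(j + n))) (f n)) v‖ ^ 2 ≤ ‖v‖ ^ 2) ?_ ?_ v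
  · intro v hv
    obtain ⟨_, h⟩ := sum_sq_entries_le f hC1 hC ⟨v, hv⟩ j
    refine (Finset.sum_le_sum fun n _ => ?_).trans (h s)
    exact le_add_of_nonneg_left (sq_nonneg _)
  · exact isClosed_le (by fun_prop) (by fun_prop)

theorem lipSeminorm_coeff_le_one (hC1 : ‖C‖ ≤ 1)
    (hC : ExtendsCommutator
      (offDiagonal (shiftedDirac T.D (-Complex.I)) (shiftedDirac T.D Complex.I))
      (doubleCLM (finiteSum T.rep α f)) C) {n : ℤ} (hn : f n ∈ T.alg) :
    T.lipSeminorm ⟨f n, hn⟩ ≤ 1 := by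
  refine T.lipSeminorm_le_of_forall _ zero_le_one fun v => ?_
  obtain ⟨hm, h⟩ := sum_sq_entries_le f hC1 hC v (-n)
  have e : T.rep (α (Multiplicative.ofAdd (-(-n + n))) (f n)) = T.rep (f n) := by
    rw [neg_add_cancel, neg_zero, ofAdd_zero, map_one]
    rfl
  have e' := congrArg (fun S : H →L[ℂ] H => S v) e
  have h1 := h {n}
  have hm' : T.rep (f n) v ∈ T.D.domain := e' ▸ hm n
  rw [Finset.sum_singleton, LinearPMap.apply_congr T.D e' _ hm', e] at h1
  refine ⟨hm', ?_⟩
  rw [one_mul]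
  refine (abs_le_of_sq_le_sq' (le_trans ?_ h1) (norm_nonneg _)).2
  exact le_add_of_nonneg_right (by positivity)

theorem norm_coeff_le_one (hfaithful : Function.Injective T.rep) (hC1 : ‖C‖ ≤ 1)
    (hC : ExtendsCommutator
      (offDiagonal (shiftedDirac T.D (-Complex.I)) (shiftedDirac T.D Complex.I))
      (doubleCLM (finiteSum T.rep α f)) C) {n : ℤ} (hn : n ≠ 0) : ‖f n‖ ≤ 1 := by
  rw [← NonUnitalStarAlgHom.norm_map T.rep hfaithful]
  refine ContinuousLinearMap.opNorm_le_bound _ zero_le_one fun v => ?_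
  have h := T.sum_sq_coeff_le hC1 hC {n} (-n) v
  rw [Finset.sum_singleton, neg_add_cancel, neg_zero, ofAdd_zero, map_one] at h
  rw [one_mul]
  refine (abs_le_of_sq_le_sq' (le_trans ?_ h) (norm_nonneg _)).2
  refine le_mul_of_one_le_left (sq_nonneg _) ?_
  have : (1 : ℤ) ≤ n ^ 2 := Int.add_one_le_of_lt (sq_pos_of_ne_zero hn)
  exact_mod_cast this

theorem finiteSum_sub_eq (f : ℤ →₀ A) (F : Finset ℤ) (π : A →⋆ₐ[ℂ] (H →L[ℂ] H)) :
    finiteSum π α f - (monomialCLM π α 0 (f 0) + ∑ n ∈ F.erase 0, monomialCLM π α n (f n)) =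
      ∑ n ∈ f.support \ insert 0 F, monomialCLM π α n (f n) := by
  have h1 : finiteSum π α f = ∑ n ∈ f.support ∪ insert 0 F, monomialCLM π α n (f n) := by
    refine Finset.sum_subset Finset.subset_union_left fun n _ hn => ?_
    change monomialCLM π α n (f n) = 0
    rw [Finsupp.notMem_support_iff.mp hn, map_zero]
  rw [h1, ← Finset.sdiff_union_self_eq_union, Finset.sum_union Finset.sdiff_disjoint,
    ← Finset.add_sum_erase (insert 0 F) _ (Finset.mem_insert_self 0 F),
    Finset.erase_insert_eq_erase, add_sub_cancel_right]

theorem norm_finiteSum_sub_le (hC1 : ‖C‖ ≤ 1)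
    (hC : ExtendsCommutator
      (offDiagonal (shiftedDirac T.D (-Complex.I)) (shiftedDirac T.D Complex.I))
      (doubleCLM (finiteSum T.rep α f)) C) {F : Finset ℤ} {ε : ℝ} (hε : 0 ≤ ε)
    (hF : ∀ t : Finset ℤ, Disjoint t F → ‖∑ n ∈ t, 1 / (n : ℝ) ^ 2‖ < ε ^ 2) :
    ‖finiteSum T.rep α f - (monomialCLM T.rep α 0 (f 0) +
      ∑ n ∈ F.erase 0, monomialCLM T.rep α n (f n))‖ ≤ ε := by
  rw [finiteSum_sub_eq]
  refine norm_sum_monomial_le (by simp) (fun j v => T.sum_sq_coeff_le hC1 hC _ j v) hε ?_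
  refine (le_abs_self _).trans (hF _ ?_).le
  exact Finset.sdiff_disjoint.mono_right (Finset.subset_insert 0 F)

theorem monomialCLM_zero_one (π : A →⋆ₐ[ℂ] (H →L[ℂ] H)) : monomialCLM π α 0 1 = 1 := by
  change covariantHom π α 1 * translation 0 = 1
  rw [map_one, translation_zero, one_mul]

end Coefficients

theorem exists_totallyBounded_approx [Nontrivial H] (hfaithful : Function.Injective T.rep)
    (hLip : T.LipschitzCondition) {ε : ℝ} (hε : 0 < ε) :
    ∃ K : Set (ℓ²(ℤ, H) →L[ℂ] ℓ²(ℤ, H)), TotallyBounded K ∧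
      ∀ (f : ℤ →₀ A) (C : WithLp 2 (ℓ²(ℤ, H) × ℓ²(ℤ, H)) →L[ℂ] WithLp 2 (ℓ²(ℤ, H) × ℓ²(ℤ, H))),
        (∀ n, f n ∈ T.alg) → ‖C‖ ≤ 1 → ExtendsCommutator
          (offDiagonal (shiftedDirac T.D (-Complex.I)) (shiftedDirac T.D Complex.I))
          (doubleCLM (finiteSum T.rep α f)) C →
        ∃ y ∈ K, y ∈ crossedProduct T.rep α ∧ ∃ c : ℂ, ‖finiteSum T.rep α f - y - c • 1‖ ≤ ε := by
  obtain ⟨v, hv⟩ := exists_norm_eq H zero_le_one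
  obtain ⟨φ, -⟩ := exists_vectorState T.rep hv
  have hK₀ := (InducesLipMetric.totallyBounded hLip T.rep hfaithful φ).image
    (monomialCLM T.rep α 0).uniformContinuous
  obtain ⟨F, hF⟩ := summable_iff_vanishing_norm.mp
    (Real.summable_one_div_int_pow.mpr one_lt_two) (ε ^ 2) (by positivity)
  have hK₁ := totallyBounded_finset_sum (T.totallyBounded_lipBall hfaithful hLip 1)
    (monomialCLM T.rep α) (F.erase 0)
  refine ⟨_, totallyBounded_add hK₀ hK₁, fun f C hf hC1 hC => ?_⟩
  have hL : ∀ n, T.lipSeminorm ⟨f n, hf n⟩ ≤ 1 := fun n =>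
    T.lipSeminorm_coeff_le_one hC1 hC (hf n)
  refine ⟨monomialCLM T.rep α 0 (f 0 - φ.1 (f 0) • 1) +
      ∑ n ∈ F.erase 0, monomialCLM T.rep α n (f n),
    ⟨_, ⟨_, ⟨⟨f 0, hf 0⟩, hL 0, rfl⟩, rfl⟩, _, ⟨f, fun n hn => ?_, rfl⟩, rfl⟩,
    add_mem (monomial_mem_crossedProduct _ _)
      (sum_mem fun n _ => monomial_mem_crossedProduct _ _), φ.1 (f 0), ?_⟩
  · exact ⟨hf n, hL n, T.norm_coeff_le_one hfaithful hC1 hC (Finset.ne_of_mem_erase hn)⟩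
  · refine le_of_eq_of_le (congrArg norm ?_) (T.norm_finiteSum_sub_le hC1 hC hε.le hF)
    rw [map_sub, map_smul, monomialCLM_zero_one]
    abel

theorem crossedTriple_lipschitzCondition (hfaithful : Function.Injective T.rep)
    (hLip : T.LipschitzCondition) (smooth : ∀ g, ∀ a ∈ T.alg, α g a ∈ T.alg)
    (hbdd : ∀ a : T.alg, BddAbove (Set.range fun g => T.lipSeminorm ⟨α g a, smooth g a a.2⟩)) :
    (T.crossedTriple smooth hbdd).LipschitzCondition := by
  refine InducesLipMetric.of_totallyBounded (OddSpectralTriple.dense_alg _)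
    (fun c x => (lipSeminorm_smul _ c x).le) fun ε hε => ?_
  rcases subsingleton_or_nontrivial H with hH | hH
  · have : Subsingleton ℓ²(ℤ, H) := ⟨fun x y => lp.ext (Subsingleton.elim _ _)⟩
    have : Subsingleton (crossedProduct T.rep α) :=
      ⟨fun x y => Subtype.ext (ContinuousLinearMap.ext fun _ => Subsingleton.elim _ _)⟩
    refine ⟨{0}, (Set.finite_singleton _).totallyBounded, fun x _ => ⟨0, rfl, 0, ?_⟩⟩
    rw [Subsingleton.elim (_ - _) 0, norm_zero]
    exact hε.le
  · obtain ⟨K, hK, happrox⟩ := T.exists_totallyBounded_approx (α := α) hfaithful hLip hε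
    refine ⟨Subtype.val ⁻¹' K,
      totallyBounded_preimage isUniformEmbedding_subtype_val.isUniformInducing hK, fun x hx => ?_⟩
    obtain ⟨f, hf, hxf⟩ := x.2
    have hC := OddSpectralTriple.extendsCommutator _ x
    obtain ⟨y, hyK, hy, c, hc⟩ := happrox f _ hf hx (by
      rw [finiteSum, ← hxf]
      exact hC)
    refine ⟨⟨y, hy⟩, hyK, c, ?_⟩
    rw [finiteSum, ← hxf] at hc
    exact hc

end OddSpectralTriple
end Main

end QuantumMetric

theorem mainTheorem2 {A : Type*} {H : Type*} [CStarAlgebra A] [NormedAddCommGroup H]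
    [InnerProductSpace ℂ H] [CompleteSpace H]
    (T : QuantumMetric.OddSpectralTriple A H) (hfaithful : Function.Injective T.rep)
    (hLip : T.LipschitzCondition)
    (α : Multiplicative ℤ →* (A ≃⋆ₐ[ℂ] A)) (hα : T.MetricallyEquicontinuous α) :
    ∃ T' : QuantumMetric.EvenSpectralTriple (QuantumMetric.crossedProduct T.rep α)
        ℓ²(ℤ, H) ℓ²(ℤ, H),
      (∀ x : QuantumMetric.crossedProduct T.rep α,
        x ∈ T'.alg ↔ (x : ℓ²(ℤ, H) →L[ℂ] ℓ²(ℤ, H)) ∈ QuantumMetric.finiteSums T.rep α T.alg) ∧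
      (∀ x : QuantumMetric.crossedProduct T.rep α, T'.rep₀ x = x ∧ T'.rep₁ x = x) ∧
      T'.D = QuantumMetric.crossedDirac T.D id ∧
      T'.LipschitzCondition := by
  obtain ⟨smooth, hbdd⟩ := hα
  exact ⟨T.crossedTriple smooth hbdd, fun x => Iff.rfl, fun x => ⟨rfl, rfl⟩,
    (QuantumMetric.OddSpectralTriple.crossedDirac_eq T.D).symm,
    T.crossedTriple_lipschitzCondition hfaithful hLip smooth hbdd⟩
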